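/- Let $R$ be a commutative Noetherian local ring with residue field $k$ which is Cohen--Macaulay, i.e. $\operatorname{depth} R=\dim R$. Call a finitely generated $R$-module $X$ maximal Cohen--Macaulay if $\operatorname{depth}_{R_{\mathfrak p}} X_{\mathfrak p}=\dim R_{\mathfrak p}$ for all $\mathfrak p\in\operatorname{Supp} X$ (so the zero module is maximal Cohen--Macaulay). Assume that $R$ has a canonical module $\omega$, i.e. a nonzero finitely generated maximal Cohen--Macaulay $R$-module of finite injective dimension and of type one (that is, $\operatorname{Ext}_R^t(k,\omega)\cong k$ for $t=\operatorname{depth}\omega$). Let $M$ and $N$ be finitely generated $R$-modules and assume that $N$ is maximal Cohen--Macaulay. Let $F_1\xrightarrow{\partial_1}F_0\to M\to0$ be the beginning of a minimal free resolution of $M$, and let $\operatorname{Tr}M=\operatorname{Coker}\big(\operatorname{Hom}_R(\partial_1,R)\colon\operatorname{Hom}_R(F_0,R)\to\operatorname{Hom}_R(F_1,R)\big)$ be the (Auslander) transpose of $M$. Then $M\otimes_RN$ is a maximal Cohen--Macaulay $R$-module if and only if $\operatorname{Tr}M\otimes_R\operatorname{Hom}_R(N,\omega)$ is a maximal Cohen--Macaulay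 $R$-module. -/

import Mathlib

open scoped TensorProduct
universe u


/-- The depth of a finitely generated module over a local ring: the supremum of the lengths of
the `M`-regular sequences contained in the maximal ideal. If `M ≠ 0` is finitely generated, then
weakly regular sequences in the maximal ideal are regular, by Nakayama's lemma. If `M = 0`, then
the value is `⊤`, which is the usual convention. -/
noncomputable def moduleDepth (R : Type*) [CommRing R] [IsLocalRing R]
    (M : Type*) [AddCommGroup M] [Module R M] : ℕ∞ :=
  sSup {n : ℕ∞ | ∃ rs : List R, (∀ r ∈ rs, r ∈ IsLocalRing.maximalIdeal R) ∧
    RingTheory.Sequence.IsWeaklyRegular M rs ∧ (rs.length : ℕ∞) = n}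

/-- A (Noetherian) local ring is Cohen–Macaulay if its depth equals its Krull dimension. -/
def IsCohenMacaulayLocal (R : Type*) [CommRing R] [IsLocalRing R] : Prop :=
  (moduleDepth R R : WithBot ℕ∞) = ringKrullDim R

/-- A (finitely generated) module `M` is maximal Cohen–Macaulay if `depth M_p = dim R_p` for all
`p` in the support of `M`. The zero module is maximal Cohen–Macaulay. -/
def IsMaximalCohenMacaulay (R : Type*) [CommRing R]
    (M : Type*) [AddCommGroup M] [Module R M] : Prop :=
  ∀ p ∈ Module.support R M,
    (moduleDepth (Localization.AtPrime p.asIdeal)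
      (LocalizedModule p.asIdeal.primeCompl M) : WithBot ℕ∞) =
        ringKrullDim (Localization.AtPrime p.asIdeal)

open CategoryTheory in
/-- A canonical module of a Cohen–Macaulay local ring `R` with residue field `k`: a nonzero
finitely generated maximal Cohen–Macaulay module of finite injective dimension and of type one,
that is, `Ext^t(k, ω)` is one-dimensional over `k`, where `t = depth ω`. -/
structure IsCanonicalModule (R : Type u) [CommRing R] [IsLocalRing R]
    (ω : Type u) [AddCommGroup ω] [Module R ω] : Prop where
  finite : Module.Finite R ω
  nontrivial : Nontrivial ω
  maximalCohenMacaulay : IsMaximalCohenMacaulay R ω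
  finite_injectiveDimension : ∃ n : ℕ, HasInjectiveDimensionLE (ModuleCat.of R ω) n
  type_one : ∃ t : ℕ, moduleDepth R ω = t ∧
    Nonempty (Abelian.Ext (ModuleCat.of R (IsLocalRing.ResidueField R)) (ModuleCat.of R ω) t
      ≃ₗ[R] IsLocalRing.ResidueField R)

/-- The beginning `R^n → R^m → M → 0` of a minimal free resolution of `M` over a local ring. -/
structure MinimalFreePresentation (R : Type*) [CommRing R] [IsLocalRing R]
    (M : Type*) [AddCommGroup M] [Module R M] where
  m : ℕ
  n : ℕ
  aug : (Fin m → R) →ₗ[R] M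
  d : (Fin n → R) →ₗ[R] (Fin m → R)
  aug_surjective : Function.Surjective aug
  exact : Function.Exact d aug
  ker_aug_le : LinearMap.ker aug ≤
    IsLocalRing.maximalIdeal R • (⊤ : Submodule R (Fin m → R))
  ker_d_le : LinearMap.ker d ≤
    IsLocalRing.maximalIdeal R • (⊤ : Submodule R (Fin n → R))

/-- The Auslander transpose of `M`: the cokernel of the `R`-dual of the first differential of a
minimal free resolution of `M`. -/
abbrev MinimalFreePresentation.transpose {R : Type*} [CommRing R] [IsLocalRing R]
    {M : Type*} [AddCommGroup M] [Module R M] (F : MinimalFreePresentation R M) : Type _ :=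
  Module.Dual R (Fin F.n → R) ⧸ LinearMap.range F.d.dualMap

theorem exists_minimal_cover (R : Type*) [CommRing R] [IsLocalRing R]
    (M : Type*) [AddCommGroup M] [Module R M] [Module.Finite R M] :
    ∃ (m : ℕ) (f : (Fin m → R) →ₗ[R] M), Function.Surjective f ∧
      LinearMap.ker f ≤ IsLocalRing.maximalIdeal R • (⊤ : Submodule R (Fin m → R)) := by
  classical
  have hex : ∃ m : ℕ, ∃ f : (Fin m → R) →ₗ[R] M, Function.Surjective f :=
    Module.Finite.exists_fin' R M
  obtain ⟨f, hf⟩ := Nat.find_spec hex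
  have hmin := fun k (hk : k < Nat.find hex) => Nat.find_min hex hk
  generalize Nat.find hex = m at f hf hmin
  refine ⟨m, f, hf, fun x hx => ?_⟩
  have key : ∀ i, x i ∈ IsLocalRing.maximalIdeal R := by
    intro i
    by_contra hi
    have hu : IsUnit (x i) := by simpa using hi
    obtain ⟨c, hc⟩ := hu.exists_left_inv
    obtain ⟨k, rfl⟩ : ∃ k, m = k + 1 := ⟨m - 1, by have := i.2; omega⟩
    refine hmin k (Nat.lt_succ_self k) ⟨f ∘ₗ (LinearMap.pi fun j : Fin (k + 1) =>
      if h : ∃ l, i.succAbove l = j then LinearMap.proj h.choose else 0), fun y => ?_⟩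
    obtain ⟨z, rfl⟩ := hf y
    refine ⟨fun l => (z - (z i * c) • x) (i.succAbove l), ?_⟩
    have : f (z - (z i * c) • x) = f z := by
      rw [map_sub, map_smul, LinearMap.mem_ker.1 hx, smul_zero, sub_zero]
    rw [← this, LinearMap.comp_apply]
    congr 1
    funext j
    rw [LinearMap.pi_apply]
    by_cases h : ∃ l, i.succAbove l = j
    · rw [dif_pos h, LinearMap.proj_apply]
      exact congrArg _ h.choose_spec
    · rw [dif_neg h]
      have hj : j = i := by
        by_contra hji
        exact h (Fin.exists_succAbove_eq hji)
      subst hj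
      simp [mul_assoc, hc]
  rw [pi_eq_sum_univ' x]
  exact Submodule.sum_mem _ fun i _ => Submodule.smul_mem_smul (key i) trivial

/-- Minimal free presentations exist. -/
instance MinimalFreePresentation.instNonempty (R : Type*) [CommRing R] [IsLocalRing R]
    [IsNoetherianRing R] (M : Type*) [AddCommGroup M] [Module R M] [Module.Finite R M] :
    Nonempty (MinimalFreePresentation R M) := by
  obtain ⟨m, f, hf, hfk⟩ := exists_minimal_cover R M
  obtain ⟨n, g, hg, hgk⟩ := exists_minimal_cover R (LinearMap.ker f)
  refine ⟨⟨m, n, f, (LinearMap.ker f).subtype ∘ₗ g, hf, ?_, hfk, ?_⟩⟩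
  · rw [LinearMap.exact_iff, LinearMap.range_comp, LinearMap.range_eq_top.2 hg,
      Submodule.map_top, Submodule.range_subtype]
  · rwa [LinearMap.ker_comp_of_ker_eq_bot _ (Submodule.ker_subtype _)]

/-! Write `X^∨` for `Hom(X, ω)` and `d` for the dimension of `R`. A finitely generated module is
maximal Cohen–Macaulay (MCM) exactly when `Ext^i(k, X) = 0` for `i < d`
(`isMaximalCohenMacaulay_iff`), so the depth lemma becomes a statement about long exact sequences.
On MCM modules `(-)^∨` is exact, preserves MCM, and is an involution (`extVanishes_succ`,
`depthAtLeast_dual`, `evalBidual_bijective`).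

Suppose `M ⊗ N` is MCM, and let `L` be the kernel of `F₁ ⊗ N → F₀ ⊗ N`. By the depth lemma all terms
and images in `0 → L → F₁ ⊗ N → F₀ ⊗ N → M ⊗ N → 0` are MCM, so its dual is exact. Since `(F ⊗ N)^∨
= F^* ⊗ N^∨`, the cokernel of `(F₀ ⊗ N)^∨ → (F₁ ⊗ N)^∨` is `Tr M ⊗ N^∨`; it is also `L^∨`, hence
MCM. The converse is the same statement for `F₀^* → F₁^* → Tr M → 0` and `N^∨`, because dualizing
twice returns `M` and `N`.

The duality rests on two facts about `ω`. Its injective dimension is at most `d`, by descending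
induction on the degree. And `R = End ω` (`lsmul_bijective`): modulo a regular sequence of length
`d`, `ω` becomes a module `E` over an Artinian ring such that `Hom(-, E)` is `Ext^d(-, ω)`; type one
bounds the socle of `E`, a length count gives `End E`, and Nakayama lifts the result. -/

/-! ### Vanishing of Ext along short exact sequences -/

section ExtVanishing

open CategoryTheory Abelian
open scoped Pointwise

/-- `Ext^i(X, Y) = 0`, for modules living in the same universe as the ring. -/
def ExtVanishes (R : Type u) [CommRing R] (X Y : Type u) [AddCommGroup X] [Module R X]
    [AddCommGroup Y] [Module R Y] (i : ℕ) : Prop :=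
  Subsingleton (Ext.{u} (ModuleCat.of R X) (ModuleCat.of R Y) i)

variable {R : Type u} [CommRing R]
variable {X X₁ X₂ X₃ Y : Type u} [AddCommGroup X] [Module R X] [AddCommGroup Y] [Module R Y]
  [AddCommGroup X₁] [Module R X₁] [AddCommGroup X₂] [Module R X₂] [AddCommGroup X₃] [Module R X₃]

theorem ExtVanishes.eq_zero {i : ℕ} (h : ExtVanishes R X Y i)
    (e : Ext (ModuleCat.of R X) (ModuleCat.of R Y) i) : e = 0 :=
  h.elim _ _

theorem ExtVanishes.of_forall {i : ℕ}
    (h : ∀ e : Ext (ModuleCat.of R X) (ModuleCat.of R Y) i, e = 0) : ExtVanishes R X Y i :=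
  subsingleton_of_forall_eq 0 h

theorem extVanishes_zero_iff : ExtVanishes R X Y 0 ↔ Subsingleton (X →ₗ[R] Y) :=
  (Ext.addEquiv₀.trans ModuleCat.homAddEquiv).subsingleton_congr

/-- The short exact sequence of module categories given by exact linear maps. -/
abbrev shortComplexOfExact (f : X₁ →ₗ[R] X₂) (g : X₂ →ₗ[R] X₃) (h : Function.Exact f g) :
    ShortComplex (ModuleCat.{u} R) :=
  ModuleCat.shortComplexOfCompEqZero f g h.linearMap_comp_eq_zero

theorem shortExact_of_exact {f : X₁ →ₗ[R] X₂} {g : X₂ →ₗ[R] X₃} (hf : Function.Injective f)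
    (h : Function.Exact f g) (hg : Function.Surjective g) :
    (shortComplexOfExact f g h).ShortExact where
  exact := ModuleCat.shortComplex_exact _ h
  mono_f := (ModuleCat.mono_iff_injective _).2 hf
  epi_g := (ModuleCat.epi_iff_surjective _).2 hg

section LongExact

variable {f : X₁ →ₗ[R] X₂} {g : X₂ →ₗ[R] X₃} (hf : Function.Injective f)
    (h : Function.Exact f g) (hg : Function.Surjective g)
include hf h hg

theorem ExtVanishes.covariant_right {i : ℕ} (h₂ : ExtVanishes R Y X₂ i)
    (h₁ : ExtVanishes R Y X₁ (i + 1)) : ExtVanishes R Y X₃ i := by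
  refine .of_forall fun e => ?_
  obtain ⟨e', rfl⟩ := Ext.covariant_sequence_exact₃ (ModuleCat.of R Y)
    (shortExact_of_exact hf h hg) e rfl (h₁.eq_zero _)
  rw [h₂.eq_zero e', Ext.zero_comp]

theorem ExtVanishes.covariant_middle {i : ℕ} (h₁ : ExtVanishes R Y X₁ i)
    (h₃ : ExtVanishes R Y X₃ i) : ExtVanishes R Y X₂ i := by
  refine .of_forall fun e => ?_
  obtain ⟨e', rfl⟩ := Ext.covariant_sequence_exact₂ (ModuleCat.of R Y)
    (shortExact_of_exact hf h hg) e (h₃.eq_zero _)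
  rw [h₁.eq_zero e', Ext.zero_comp]

theorem ExtVanishes.covariant_left {i : ℕ} (h₃ : ExtVanishes R Y X₃ i)
    (h₂ : ExtVanishes R Y X₂ (i + 1)) : ExtVanishes R Y X₁ (i + 1) := by
  refine .of_forall fun e => ?_
  obtain ⟨e', rfl⟩ := Ext.covariant_sequence_exact₁ (ModuleCat.of R Y)
    (shortExact_of_exact hf h hg) e (h₂.eq_zero _) rfl
  rw [h₃.eq_zero e', Ext.zero_comp]

theorem ExtVanishes.contravariant_left {i : ℕ} (h₂ : ExtVanishes R X₂ Y i)
    (h₃ : ExtVanishes R X₃ Y (i + 1)) : ExtVanishes R X₁ Y i := by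
  refine .of_forall fun e => ?_
  obtain ⟨e', rfl⟩ := Ext.contravariant_sequence_exact₁
    (shortExact_of_exact hf h hg) (ModuleCat.of R Y) e (add_comm 1 i) (h₃.eq_zero _)
  rw [h₂.eq_zero e', Ext.comp_zero]

theorem ExtVanishes.contravariant_middle {i : ℕ} (h₁ : ExtVanishes R X₁ Y i)
    (h₃ : ExtVanishes R X₃ Y i) : ExtVanishes R X₂ Y i := by
  refine .of_forall fun e => ?_
  obtain ⟨e', rfl⟩ := Ext.contravariant_sequence_exact₂
    (shortExact_of_exact hf h hg) (ModuleCat.of R Y) e (h₁.eq_zero _)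
  rw [h₃.eq_zero e', Ext.comp_zero]

theorem ExtVanishes.contravariant_right {i : ℕ} (h₁ : ExtVanishes R X₁ Y i)
    (h₂ : ExtVanishes R X₂ Y (i + 1)) : ExtVanishes R X₃ Y (i + 1) := by
  refine .of_forall fun e => ?_
  obtain ⟨e', rfl⟩ := Ext.contravariant_sequence_exact₃
    (shortExact_of_exact hf h hg) (ModuleCat.of R Y) e (h₂.eq_zero _) (add_comm 1 i)
  rw [h₁.eq_zero e', Ext.comp_zero]

theorem ExtVanishes.exists_extension (h₃ : ExtVanishes R X₃ Y 1) (φ : X₁ →ₗ[R] Y) :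
    ∃ ψ : X₂ →ₗ[R] Y, ψ ∘ₗ f = φ := by
  obtain ⟨e, he⟩ := Ext.contravariant_sequence_exact₁
    (shortExact_of_exact hf h hg) (ModuleCat.of R Y) (Ext.mk₀ (ModuleCat.ofHom φ)) rfl
    (h₃.eq_zero _)
  obtain ⟨ψ, rfl⟩ := (Ext.mk₀_bijective _ _).2 e
  rw [Ext.mk₀_comp_mk₀] at he
  exact ⟨ψ.hom, congrArg ModuleCat.Hom.hom ((Ext.mk₀_bijective _ _).1 he)⟩

theorem ExtVanishes.exists_lift (h₁ : ExtVanishes R Y X₁ 1) (φ : Y →ₗ[R] X₃) :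
    ∃ ψ : Y →ₗ[R] X₂, g ∘ₗ ψ = φ := by
  obtain ⟨e, he⟩ := Ext.covariant_sequence_exact₃ (ModuleCat.of R Y)
    (shortExact_of_exact hf h hg) (Ext.mk₀ (ModuleCat.ofHom φ)) (n₁ := 1) rfl
    (h₁.eq_zero _)
  obtain ⟨ψ, rfl⟩ := (Ext.mk₀_bijective _ _).2 e
  rw [Ext.mk₀_comp_mk₀] at he
  exact ⟨ψ.hom, congrArg ModuleCat.Hom.hom ((Ext.mk₀_bijective _ _).1 he)⟩

end LongExact

theorem ExtVanishes.congr {X' Y' : Type u} [AddCommGroup X'] [Module R X'] [AddCommGroup Y']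
    [Module R Y'] (e₁ : X ≃ₗ[R] X') (e₂ : Y ≃ₗ[R] Y') {i : ℕ} (h : ExtVanishes R X Y i) :
    ExtVanishes R X' Y' i := by
  refine .of_forall fun e => ?_
  have h0 := h.eq_zero (((Ext.mk₀ e₁.toModuleIso.hom).comp e (zero_add i)).comp
    (Ext.mk₀ e₂.toModuleIso.inv) (add_zero i))
  have h1 := congrArg (fun a => ((Ext.mk₀ e₁.toModuleIso.inv).comp a (zero_add i)).comp
    (Ext.mk₀ e₂.toModuleIso.hom) (add_zero i)) h0
  simpa only [Ext.comp_assoc_of_third_deg_zero, Ext.mk₀_comp_mk₀, Iso.inv_hom_id,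
    Ext.mk₀_comp_mk₀_assoc, Ext.comp_mk₀_id, Ext.mk₀_id_comp, Ext.zero_comp, Ext.comp_zero] using h1

theorem extVanishes_of_projective [Module.Projective R X] (i : ℕ) : ExtVanishes R X Y (i + 1) := by
  have : Projective (ModuleCat.of R X) := inferInstance
  exact Ext.subsingleton_of_projective _ _ _

theorem ext_smul_eq_zero_of_mem_annihilator {r : R} (hr : r ∈ Module.annihilator R X) {i : ℕ}
    (e : Ext (ModuleCat.of R X) (ModuleCat.of R Y) i) : r • e = 0 := by
  have h0 : r • 𝟙 (ModuleCat.of R X) = 0 := by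
    ext x
    simpa using Module.mem_annihilator.1 hr x
  have h1 : r • e = (Ext.mk₀ (r • 𝟙 (ModuleCat.of R X))).comp e (zero_add i) := by
    simp [Ext.mk₀_smul]
  rw [h1, h0, Ext.mk₀_zero, Ext.zero_comp]

theorem comp_mk₀_lsmul {M : ModuleCat.{u} R} (x : R) {i : ℕ} (e : Ext M (ModuleCat.of R Y) i) :
    e.comp (Ext.mk₀ (ModuleCat.ofHom (LinearMap.lsmul R Y x))) (add_zero i) = x • e := by
  have : ModuleCat.ofHom (LinearMap.lsmul R Y x) = x • 𝟙 (ModuleCat.of R Y) := rfl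
  rw [this, Ext.mk₀_smul, Ext.comp_smul, Ext.comp_mk₀_id]

theorem mk₀_lsmul_comp {M : ModuleCat.{u} R} (x : R) {i : ℕ} (e : Ext (ModuleCat.of R X) M i) :
    (Ext.mk₀ (ModuleCat.ofHom (LinearMap.lsmul R X x))).comp e (zero_add i) = x • e := by
  have : ModuleCat.ofHom (LinearMap.lsmul R X x) = x • 𝟙 (ModuleCat.of R X) := rfl
  rw [this, Ext.mk₀_smul, Ext.smul_comp, Ext.mk₀_id_comp]

theorem exact_lsmul_mkQ (Y : Type u) [AddCommGroup Y] [Module R Y] (x : R) :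
    Function.Exact (LinearMap.lsmul R Y x) (Submodule.mkQ (x • (⊤ : Submodule R Y))) :=
  LinearMap.exact_lsmul_mkQ_smul_top Y x

theorem lsmul_injective {x : R} (hx : IsSMulRegular Y x) :
    Function.Injective (LinearMap.lsmul R Y x) := hx

/-- A class killed by `x` comes from `Ext^i(X, Y/xY)` through the connecting map. When `x` also
kills `X`, this forces `Ext^{i+1}(X, Y) = 0`. -/
theorem ext_isSMulRegular_of_quotSMulTop {x : R} (hx : IsSMulRegular Y x) {i : ℕ}
    (h : ExtVanishes R X (QuotSMulTop x Y) i) :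
    IsSMulRegular (Ext (ModuleCat.of R X) (ModuleCat.of R Y) (i + 1)) x := by
  rw [isSMulRegular_iff_right_eq_zero_of_smul]
  intro e he
  obtain ⟨e', rfl⟩ := Ext.covariant_sequence_exact₁ (ModuleCat.of R X)
    (shortExact_of_exact (lsmul_injective hx) (exact_lsmul_mkQ Y x) (Submodule.mkQ_surjective _)) e
    ((comp_mk₀_lsmul x e).trans he) rfl
  rw [show e' = 0 from ExtVanishes.eq_zero h e', Ext.zero_comp]

section Local

variable [IsLocalRing R] [IsNoetherianRing R]

/-- Nakayama, applied to the finitely generated module `Ext^i(X, Y)`. -/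
theorem ExtVanishes.of_smul_surjective [Module.Finite R X] [Module.Finite R Y] {x : R}
    (hx : x ∈ IsLocalRing.maximalIdeal R) {i : ℕ}
    (h : ∀ e : Ext (ModuleCat.of R X) (ModuleCat.of R Y) i, ∃ e', x • e' = e) :
    ExtVanishes R X Y i := by
  rw [ExtVanishes, ← Submodule.subsingleton_iff R, ← subsingleton_iff_bot_eq_top, eq_comm]
  refine Submodule.eq_bot_of_le_smul_of_le_jacobson_bot (Ideal.span {x}) _ Module.Finite.fg_top
    (fun e _ => ?_) ?_
  · obtain ⟨e', rfl⟩ := h e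
    exact Submodule.smul_mem_smul (Ideal.mem_span_singleton_self x) trivial
  · rw [IsLocalRing.jacobson_eq_maximalIdeal _ bot_ne_top, Ideal.span_singleton_le_iff_mem]
    exact hx

/-- The cokernel of `x` on `Ext^i(X, Y)` embeds in `Ext^{i+1}(X/xX, Y)`. -/
theorem ExtVanishes.of_quotSMulTop_left [Module.Finite R X] [Module.Finite R Y] {x : R}
    (hx : x ∈ IsLocalRing.maximalIdeal R) (hreg : IsSMulRegular X x) {i : ℕ}
    (h : ExtVanishes R (QuotSMulTop x X) Y (i + 1)) : ExtVanishes R X Y i := by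
  refine .of_smul_surjective hx fun e => ?_
  obtain ⟨e', he'⟩ := Ext.contravariant_sequence_exact₁
    (shortExact_of_exact (lsmul_injective hreg) (exact_lsmul_mkQ X x) (Submodule.mkQ_surjective _))
    (ModuleCat.of R Y) e (add_comm 1 i) (h.eq_zero _)
  exact ⟨e', (mk₀_lsmul_comp x e').symm.trans he'⟩

end Local

end ExtVanishing

/-! ### Depth through Ext, and its behaviour under localization -/

section Depth

open CategoryTheory Abelian IsLocalRing RingTheory.Sequence
open scoped Pointwise

/-- `Ext^i(k, X) = 0` for `i < n`, where `k` is the residue field: for a finitely generated module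
this says that the depth of `X` is at least `n`, with the depth of `0` being infinite. -/
def DepthAtLeast (R : Type u) [CommRing R] [IsLocalRing R] (n : ℕ) (X : Type u) [AddCommGroup X]
    [Module R X] : Prop :=
  ∀ i < n, ExtVanishes R (ResidueField R) X i

variable {R : Type u} [CommRing R] [IsLocalRing R]
variable {X X₁ X₂ X₃ Y : Type u} [AddCommGroup X] [Module R X] [AddCommGroup Y] [Module R Y]
  [AddCommGroup X₁] [Module R X₁] [AddCommGroup X₂] [Module R X₂] [AddCommGroup X₃] [Module R X₃]

theorem DepthAtLeast.congr (e : X ≃ₗ[R] Y) {n : ℕ} (h : DepthAtLeast R n X) :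
    DepthAtLeast R n Y := fun i hi => (h i hi).congr (LinearEquiv.refl _ _) e

theorem DepthAtLeast.mono {m n : ℕ} (hmn : m ≤ n) (h : DepthAtLeast R n X) :
    DepthAtLeast R m X := fun i hi => h i (hi.trans_le hmn)

theorem depthAtLeast_of_subsingleton [Subsingleton X] {n : ℕ} : DepthAtLeast R n X := by
  refine fun i _ => .of_forall fun e => ?_
  have : 𝟙 (ModuleCat.of R X) = 0 := ModuleCat.hom_ext (LinearMap.ext fun x =>
    Subsingleton.elim (α := X) _ _)
  rw [← e.comp_mk₀_id, this, Ext.mk₀_zero, Ext.comp_zero]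

theorem depthAtLeast_zero : DepthAtLeast R 0 X := fun i hi => absurd hi (Nat.not_lt_zero i)

section Exact

variable {f : X₁ →ₗ[R] X₂} {g : X₂ →ₗ[R] X₃} (hf : Function.Injective f)
    (h : Function.Exact f g) (hg : Function.Surjective g)
include hf h hg

/-- The depth lemma with its gain of one: `Ext^i(k, X₃)` only affects `Ext^{i+1}(k, X₁)`, while
degree zero is left exactness of Hom. -/
theorem DepthAtLeast.of_exact_left {n : ℕ} (h₂ : DepthAtLeast R (n + 1) X₂)
    (h₃ : DepthAtLeast R n X₃) : DepthAtLeast R (n + 1) X₁ := by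
  rintro (_ | i) hi
  · have h0 := extVanishes_zero_iff.1 (h₂ 0 n.succ_pos)
    refine extVanishes_zero_iff.2 (subsingleton_of_forall_eq 0 fun φ => ?_)
    ext x
    exact hf (by simpa using LinearMap.congr_fun (h0.elim (f ∘ₗ φ) 0) x)
  · exact (h₃ i (by omega)).covariant_left hf h hg (h₂ (i + 1) hi)

theorem DepthAtLeast.of_exact_left' {n : ℕ} (h₂ : DepthAtLeast R n X₂)
    (h₃ : DepthAtLeast R n X₃) : DepthAtLeast R n X₁ := by
  cases n with
  | zero => exact depthAtLeast_zero
  | succ n => exact h₂.of_exact_left hf h hg (h₃.mono n.le_succ)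

theorem DepthAtLeast.of_exact_middle {n : ℕ} (h₁ : DepthAtLeast R n X₁)
    (h₃ : DepthAtLeast R n X₃) : DepthAtLeast R n X₂ :=
  fun i hi => (h₁ i hi).covariant_middle hf h hg (h₃ i hi)

theorem DepthAtLeast.of_exact_right {n : ℕ} (h₁ : DepthAtLeast R (n + 1) X₁)
    (h₂ : DepthAtLeast R n X₂) : DepthAtLeast R n X₃ :=
  fun i hi => (h₂ i hi).covariant_right hf h hg (h₁ (i + 1) (by omega))

end Exact

theorem DepthAtLeast.quotSMulTop {n : ℕ} (h : DepthAtLeast R (n + 1) X) {x : R}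
    (hx : IsSMulRegular X x) : DepthAtLeast R n (QuotSMulTop x X) :=
  h.of_exact_right (lsmul_injective hx) (exact_lsmul_mkQ X x) (Submodule.mkQ_surjective _)
    (h.mono n.le_succ)

theorem DepthAtLeast.pi {n : ℕ} (h : DepthAtLeast R n X) (m : ℕ) :
    DepthAtLeast R n (Fin m → X) := by
  induction m with
  | zero =>
    exact depthAtLeast_of_subsingleton
  | succ m ih =>
    let e : (X × (Fin m → X)) ≃ₗ[R] (Fin (m + 1) → X) := Fin.consLinearEquiv R (fun _ => X)
    refine DepthAtLeast.congr e (DepthAtLeast.of_exact_middle (f := LinearMap.inl R X (Fin m → X))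
      (g := LinearMap.snd R X (Fin m → X)) LinearMap.inl_injective ?_
      LinearMap.snd_surjective h ih)
    exact Function.Exact.inl_snd

theorem support_residueField : Module.support R (ResidueField R) =
    PrimeSpectrum.zeroLocus (maximalIdeal R) := by
  change Module.support R (R ⧸ maximalIdeal R) = _
  rw [Module.support_eq_zeroLocus, Ideal.annihilator_quotient]

variable [IsNoetherianRing R]

/-- Rees' theorem: depth is detected by regular sequences. -/
theorem depthAtLeast_iff_exists_isWeaklyRegular [Module.Finite R X] {n : ℕ} :
    DepthAtLeast R n X ↔ ∃ rs : List R, (∀ r ∈ rs, r ∈ maximalIdeal R) ∧ IsWeaklyRegular X rs ∧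
      rs.length = n := by
  rcases subsingleton_or_nontrivial X with hX | hX
  · refine iff_of_true depthAtLeast_of_subsingleton ⟨List.replicate n 0, ?_, ⟨?_⟩, by simp⟩
    · simp +contextual [List.mem_replicate]
    · intro i hi
      exact fun a b _ => Subsingleton.elim a b
  · have hlt : maximalIdeal R • (⊤ : Submodule R X) < ⊤ :=
      (Submodule.top_ne_ideal_smul_of_le_jacobson_annihilator
        (maximalIdeal_le_jacobson _)).symm.lt_top
    constructor
    · intro h
      obtain ⟨rs, h1, h2, h3⟩ := ModuleCat.exists_isRegular_of_exists_subsingleton_ext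
        (maximalIdeal R) n (ModuleCat.of R X) hlt (ModuleCat.of R (ResidueField R))
        support_residueField h
      exact ⟨rs, h2, h3.toIsWeaklyRegular, h1⟩
    · rintro ⟨rs, h2, h3, rfl⟩
      exact ModuleCat.subsingleton_ext_of_exists_isRegular (maximalIdeal R)
        (ModuleCat.of R (ResidueField R)) support_residueField.subset (ModuleCat.of R X) hlt rs h2
        (IsRegular.of_isWeaklyRegular_of_mem_maximalIdeal _ h2 h3)

omit [IsLocalRing R] in
-- The zero divisors on `X` form the union of finitely many associated primes; prime avoidance
-- applies.
theorem exists_mem_associatedPrimes_le [Module.Finite R X] {p : Ideal R}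
    (h : ∀ x ∈ p, ¬ IsSMulRegular X x) : ∃ q ∈ associatedPrimes R X, p ≤ q := by
  have hX : Nontrivial X := by
    by_contra hX
    rw [not_nontrivial_iff_subsingleton] at hX
    exact h 0 p.zero_mem fun a b _ => Subsingleton.elim a b
  obtain ⟨q, hq⟩ := associatedPrimes.nonempty R X
  refine (Ideal.subset_union_prime_finite (associatedPrimes.finite R X) q q
    fun I hI _ _ => IsAssociatedPrime.isPrime hI).1 ?_
  rw [biUnion_associatedPrimes_eq_compl_regular R X]
  exact fun r hr => h r hr

/-- Let `U` be the submodule killed by `q`. If `U ≤ xX`, regularity of `x` gives `U = xU`, so `U =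
0` by Nakayama, which is absurd. Hence some `u ∈ U` is nonzero in `X/xX`; an associated prime above
its annihilator contains `q` and also `x`, and `x ∉ q`. -/
theorem exists_mem_associatedPrimes_quotSMulTop [Module.Finite R X] {x : R}
    (hx : x ∈ maximalIdeal R) (hreg : IsSMulRegular X x) {q : Ideal R}
    (hq : q ∈ associatedPrimes R X) :
    ∃ q' ∈ associatedPrimes R (QuotSMulTop x X), q < q' := by
  have hqp : q.IsPrime := hq.isPrime
  obtain ⟨y, hy⟩ := (isAssociatedPrime_iff.1 (AssociatedPrimes.mem_iff.1 hq)).2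
  have hxq : x ∉ q := by
    intro hxq
    have h1 : x • y = 0 := by rw [hy] at hxq; simpa using hxq
    have h2 : y = 0 := hreg (by simpa using h1)
    exact hqp.ne_top (by rw [hy, h2, Ideal.eq_top_iff_one]; simp)
  let U : Submodule R X := Submodule.torsionBySet R X q
  have hyU : y ∈ U := by
    rw [Submodule.mem_torsionBySet_iff]
    rintro ⟨a, ha⟩
    change a ∈ q at ha
    rw [hy] at ha
    simpa using ha
  have hU : ¬ U ≤ x • (⊤ : Submodule R X) := by
    intro hU
    have hU0 : U = ⊥ := by
      refine Submodule.eq_bot_of_le_smul_of_le_jacobson_bot (Ideal.span {x}) U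
        (IsNoetherian.noetherian U) (fun u hu => ?_) ?_
      · obtain ⟨v, -, rfl⟩ := Submodule.mem_smul_pointwise_iff_exists _ _ _ |>.1 (hU hu)
        refine Submodule.smul_mem_smul (Ideal.mem_span_singleton_self x) ?_
        rw [Submodule.mem_torsionBySet_iff] at hu ⊢
        intro a
        refine hreg ?_
        have := hu a
        change x • (a : R) • v = x • 0
        rw [smul_comm, this, smul_zero]
      · rw [jacobson_eq_maximalIdeal _ bot_ne_top, Ideal.span_singleton_le_iff_mem]
        exact hx
    have h2 : y = 0 := by simpa [hU0] using hyU
    exact hqp.ne_top (by rw [hy, h2, Ideal.eq_top_iff_one]; simp)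
  obtain ⟨u, hu, hux⟩ := SetLike.not_le_iff_exists.1 hU
  have hu0 : (Submodule.Quotient.mk u : QuotSMulTop x X) ≠ 0 := by
    rwa [Ne, Submodule.Quotient.mk_eq_zero]
  obtain ⟨q', hq', hle⟩ := exists_le_isAssociatedPrime_of_isNoetherianRing R _ hu0
  have hmem : ∀ a : R, a • u ∈ x • (⊤ : Submodule R X) → a ∈ q' := by
    intro a ha
    refine hle ?_
    rw [← Submodule.Quotient.mk_eq_zero, Submodule.Quotient.mk_smul] at ha
    simpa using ha
  refine ⟨q', hq', lt_of_le_of_ne (fun a ha => hmem a ?_) ?_⟩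
  · rw [Submodule.mem_torsionBySet_iff] at hu
    rw [show a • u = 0 from hu ⟨a, ha⟩]
    exact Submodule.zero_mem _
  · rintro rfl
    exact hxq (hmem x (Submodule.smul_mem_pointwise_smul _ _ _ trivial))

/-- Each element of the sequence moves an associated prime strictly upwards: depth is at most `dim
R/q`. -/
theorem IsWeaklyRegular.length_le_coheight [Module.Finite R X] {rs : List R}
    (h : IsWeaklyRegular X rs) (hrs : ∀ r ∈ rs, r ∈ maximalIdeal R) (q : PrimeSpectrum R)
    (hq : q.asIdeal ∈ associatedPrimes R X) : (rs.length : ℕ∞) ≤ Order.coheight q := by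
  induction rs generalizing X q with
  | nil => simp
  | cons r rs ih =>
    rw [isWeaklyRegular_cons_iff] at h
    simp only [List.mem_cons, forall_eq_or_imp] at hrs
    obtain ⟨q', hq', hlt⟩ := exists_mem_associatedPrimes_quotSMulTop hrs.1 h.1 hq
    have := ih h.2 hrs.2 ⟨q', hq'.isPrime⟩ hq'
    have hlt' : q < ⟨q', hq'.isPrime⟩ := hlt
    simp only [List.length_cons, Nat.cast_add, Nat.cast_one]
    exact (add_le_add_left this 1).trans (Order.coheight_add_one_le hlt')

/-- If `p` consisted of zero divisors it would lie in an associated prime `q`, giving `n ≤ coheight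
q ≤ coheight p`, too small for `j ≥ 1`. With `j` the height of `p`, this bounds the depth at `p`
from below. -/
theorem DepthAtLeast.exists_isWeaklyRegular_mem [Module.Finite R X] {n : ℕ}
    (h : DepthAtLeast R n X) (p : PrimeSpectrum R) (j : ℕ)
    (hj : Order.coheight p + j ≤ n) :
    ∃ rs : List R, (∀ r ∈ rs, r ∈ p.asIdeal) ∧ IsWeaklyRegular X rs ∧ rs.length = j := by
  induction j generalizing X n with
  | zero => exact ⟨[], by simp, IsWeaklyRegular.nil _ _, rfl⟩
  | succ j ih =>
    obtain ⟨x, hxp, hx⟩ : ∃ x ∈ p.asIdeal, IsSMulRegular X x := by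
      by_contra! hcon
      obtain ⟨q, hq, hpq⟩ := exists_mem_associatedPrimes_le hcon
      obtain ⟨rs, h1, h2, rfl⟩ := depthAtLeast_iff_exists_isWeaklyRegular.1 h
      have h3 := IsWeaklyRegular.length_le_coheight h2 h1 ⟨q, hq.isPrime⟩ hq
      have h4 : Order.coheight (⟨q, hq.isPrime⟩ : PrimeSpectrum R) ≤ Order.coheight p :=
        Order.coheight_anti hpq
      have h5 := hj.trans (h3.trans h4)
      have h6 : Order.coheight p ≠ ⊤ := by
        intro htop
        rw [htop] at hj
        simp at hj
      lift Order.coheight p to ℕ using h6 with c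
      norm_cast at h5
      omega
    have hn : ∃ n', n = n' + 1 := by
      cases n with
      | zero => simp at hj
      | succ n => exact ⟨n, rfl⟩
    obtain ⟨n, rfl⟩ := hn
    obtain ⟨rs, h1, h2, h3⟩ := ih (h.quotSMulTop hx) (by
      rw [Nat.cast_add, Nat.cast_add, ← add_assoc] at hj
      exact (ENat.add_le_add_iff_right (by simp)).1 hj)
    refine ⟨x :: rs, ?_, h2.cons hx, by simp [h3]⟩
    simpa using ⟨hxp, h1⟩

theorem IsWeaklyRegular.length_le_ringKrullDim {A M : Type*} [CommRing A] [IsLocalRing A]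
    [IsNoetherianRing A] [AddCommGroup M] [Module A M] [Module.Finite A M] [Nontrivial M]
    {rs : List A} (hrs : ∀ r ∈ rs, r ∈ maximalIdeal A) (h : IsWeaklyRegular M rs) :
    (rs.length : WithBot ℕ∞) ≤ ringKrullDim A := by
  have hreg := IsRegular.of_isWeaklyRegular_of_mem_maximalIdeal M hrs h
  refine le_trans ?_ (Module.supportDim_le_ringKrullDim A M)
  rw [← Module.supportDim_add_length_eq_supportDim_of_isRegular rs hreg]
  have : Nontrivial (M ⧸ Ideal.ofList rs • (⊤ : Submodule A M)) :=
    hreg.quot_ofList_smul_nontrivial ⊤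
  have h0 : (0 : WithBot ℕ∞) ≤
      Module.supportDim A (M ⧸ Ideal.ofList rs • (⊤ : Submodule A M)) := by
    rw [Module.supportDim_eq_ringKrullDim_quotient_annihilator]
    have : Nontrivial (A ⧸ Module.annihilator A (M ⧸ Ideal.ofList rs • (⊤ : Submodule A M))) :=
      Ideal.Quotient.nontrivial_iff.2 (Module.annihilator_eq_top_iff.not.2 (not_subsingleton _))
    exact ringKrullDim_nonneg_of_nontrivial
  simpa using add_le_add_left h0 (rs.length : WithBot ℕ∞)

theorem moduleDepth_le_ringKrullDim {A M : Type*} [CommRing A] [IsLocalRing A]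
    [IsNoetherianRing A] [AddCommGroup M] [Module A M] [Module.Finite A M] [Nontrivial M] :
    (moduleDepth A M : WithBot ℕ∞) ≤ ringKrullDim A := by
  obtain ⟨d, hd⟩ : ∃ d : ℕ∞, ringKrullDim A = d := by
    refine ⟨_, (WithBot.coe_unbot (ringKrullDim A) ?_).symm⟩
    exact ringKrullDim_ne_bot
  rw [hd, WithBot.coe_le_coe]
  refine sSup_le ?_
  rintro _ ⟨rs, h1, h2, rfl⟩
  have := IsWeaklyRegular.length_le_ringKrullDim h1 h2
  rw [hd] at this
  exact_mod_cast this

theorem le_moduleDepth {A M : Type*} [CommRing A] [IsLocalRing A] [AddCommGroup M] [Module A M]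
    {rs : List A} (hrs : ∀ r ∈ rs, r ∈ maximalIdeal A) (h : IsWeaklyRegular M rs) :
    (rs.length : ℕ∞) ≤ moduleDepth A M :=
  le_sSup ⟨rs, hrs, h, rfl⟩

theorem exists_isWeaklyRegular_of_moduleDepth_eq {A M : Type*} [CommRing A] [IsLocalRing A]
    [AddCommGroup M] [Module A M] {n : ℕ} (h : moduleDepth A M = n) :
    ∃ rs : List A, (∀ r ∈ rs, r ∈ maximalIdeal A) ∧ IsWeaklyRegular M rs ∧ rs.length = n := by
  cases n with
  | zero => exact ⟨[], by simp, IsWeaklyRegular.nil _ _, rfl⟩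
  | succ n =>
    have h1 : (n : ℕ∞) < moduleDepth A M := by rw [h]; exact_mod_cast n.lt_succ_self
    obtain ⟨_, ⟨rs, h2, h3, rfl⟩, h4⟩ := lt_sSup_iff.1 h1
    have h5 := (le_moduleDepth h2 h3).trans_eq h
    norm_cast at h4 h5
    exact ⟨rs, h2, h3, by omega⟩

theorem DepthAtLeast.isMaximalCohenMacaulay [Module.Finite R X] {d : ℕ}
    (hd : ringKrullDim R = d) (h : DepthAtLeast R d X) : IsMaximalCohenMacaulay R X := by
  intro p hp
  have : Nontrivial (LocalizedModule p.asIdeal.primeCompl X) := hp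
  have : IsNoetherianRing (Localization.AtPrime p.asIdeal) :=
    IsLocalization.isNoetherianRing p.asIdeal.primeCompl _ inferInstance
  refine le_antisymm moduleDepth_le_ringKrullDim ?_
  have hle : (Order.height p + Order.coheight p : ℕ∞) ≤ d := by
    have : ((Order.height p + Order.coheight p : ℕ∞) : WithBot ℕ∞) ≤ ringKrullDim R :=
      (le_iSup (fun q : PrimeSpectrum R => (Order.height q + Order.coheight q : ℕ∞)) p |>
        WithBot.coe_le_coe.2).trans_eq
        (Order.krullDim_eq_iSup_height_add_coheight_of_nonempty).symm
    rw [hd] at this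
    exact_mod_cast this
  have hht : Order.height p ≠ ⊤ := by
    intro htop
    simp [htop] at hle
  obtain ⟨c, hc⟩ := ENat.ne_top_iff_exists.1 hht
  rw [← hc, add_comm] at hle
  obtain ⟨rs, h1, h2, h3⟩ := h.exists_isWeaklyRegular_mem p c hle
  have h4 := h2.of_isLocalizedModule (Localization.AtPrime p.asIdeal) p.asIdeal.primeCompl
    (LocalizedModule.mkLinearMap p.asIdeal.primeCompl X)
  have h5 := le_moduleDepth (fun r hr => by
    obtain ⟨s, hs, rfl⟩ := List.mem_map.1 hr
    exact (IsLocalization.AtPrime.to_map_mem_maximal_iff _ p.asIdeal s).2 (h1 s hs)) h4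
  rw [IsLocalization.AtPrime.ringKrullDim_eq_height p.asIdeal]
  rw [List.length_map, h3, hc] at h5
  rw [PrimeSpectrum.height_eq_orderHeight]
  exact WithBot.coe_le_coe.2 h5

theorem IsMaximalCohenMacaulay.depthAtLeast [Module.Finite R X] {d : ℕ}
    (hd : ringKrullDim R = d) (h : IsMaximalCohenMacaulay R X) : DepthAtLeast R d X := by
  rw [depthAtLeast_iff_exists_isWeaklyRegular]
  rcases subsingleton_or_nontrivial X with hX | hX
  · exact depthAtLeast_iff_exists_isWeaklyRegular.1 depthAtLeast_of_subsingleton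
  have h1 := h (closedPoint R) (by
    rw [Module.mem_support_iff_of_finite]
    exact le_maximalIdeal (Module.annihilator_eq_top_iff.not.2 (not_subsingleton X)))
  have hdim : ringKrullDim (Localization.AtPrime (closedPoint R).asIdeal) = d :=
    (IsLocalization.AtPrime.ringKrullDim_eq_height (closedPoint R).asIdeal _).trans
      (maximalIdeal_height_eq_ringKrullDim.trans hd)
  rw [hdim] at h1
  obtain ⟨rs, h2, h3, h4⟩ := exists_isWeaklyRegular_of_moduleDepth_eq (n := d)
    (by exact_mod_cast h1)
  -- Localizing at the closed point inverts only units, so the regular sequence can be carried back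
  -- to `R`.
  have hunits : (closedPoint R).asIdeal.primeCompl ≤ IsUnit.submonoid R := fun a ha => by
    have : a ∉ maximalIdeal R := ha
    exact not_not.1 fun hu => this ((mem_maximalIdeal a).2 hu)
  let e := IsLocalization.atUnits R (closedPoint R).asIdeal.primeCompl
    (S := Localization.AtPrime (closedPoint R).asIdeal) hunits
  have hrs : (rs.map e.symm).map (algebraMap R _) = rs := by
    rw [List.map_map]
    conv_rhs => rw [← List.map_id rs]
    refine List.map_congr_left fun a _ => ?_
    change algebraMap R _ (e.symm a) = a
    rw [← e.commutes (e.symm a)]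
    simp
  have := IsLocalization.self hunits
  have : IsLocalizedModule (closedPoint R).asIdeal.primeCompl (LinearMap.id : X →ₗ[R] X) :=
    isLocalizedModule_id _ X R
  rw [← hrs, isWeaklyRegular_map_algebraMap_iff] at h3
  refine ⟨rs.map e.symm, fun r hr => ?_, (LinearEquiv.isWeaklyRegular_congr
    (IsLocalizedModule.linearEquiv (closedPoint R).asIdeal.primeCompl
      (LocalizedModule.mkLinearMap (closedPoint R).asIdeal.primeCompl X)
      (LinearMap.id : X →ₗ[R] X)) _).1 h3, by rw [List.length_map, h4]⟩
  refine (IsLocalization.AtPrime.to_map_mem_maximal_iff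
    (Localization.AtPrime (closedPoint R).asIdeal) (closedPoint R).asIdeal r).1 (h2 _ ?_)
  rw [← hrs]
  exact List.mem_map_of_mem hr

theorem isMaximalCohenMacaulay_iff [Module.Finite R X] {d : ℕ} (hd : ringKrullDim R = d) :
    IsMaximalCohenMacaulay R X ↔ DepthAtLeast R d X :=
  ⟨fun h => h.depthAtLeast hd, fun h => h.isMaximalCohenMacaulay hd⟩

end Depth

/-! ### Injective dimension of the canonical module, and duals of MCM modules -/

section Dualizing

open CategoryTheory Abelian IsLocalRing RingTheory.Sequence
open scoped Pointwise

/-- The homological properties of a canonical module `ω` over a Cohen–Macaulay local ring of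
dimension `d`. -/
structure IsDualizing (R : Type u) [CommRing R] [IsLocalRing R] (ω : Type u) [AddCommGroup ω]
    [Module R ω] (d : ℕ) : Prop where
  finite : Module.Finite R ω
  ringKrullDim_eq : ringKrullDim R = d
  depth_ring : DepthAtLeast R d R
  depth : DepthAtLeast R d ω
  extVanishes_of_gt : ∀ (X : Type u) [AddCommGroup X] [Module R X] [Module.Finite R X] (i : ℕ),
    d < i → ExtVanishes R X ω i
  type_one : Nonempty (Ext (ModuleCat.of R (ResidueField R)) (ModuleCat.of R ω) d
      ≃ₗ[R] ResidueField R)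

variable {R : Type u} [CommRing R] [IsLocalRing R]
variable {X Y ω : Type u} [AddCommGroup X] [Module R X] [AddCommGroup Y] [Module R Y]
  [AddCommGroup ω] [Module R ω]

theorem maximalIdeal_le_annihilator_residueField :
    maximalIdeal R ≤ Module.annihilator R (ResidueField R) :=
  (Ideal.annihilator_quotient (I := maximalIdeal R)).ge

instance isSimpleModule_residueField : IsSimpleModule R (ResidueField R) :=
  isSimpleModule_iff_quot_maximal.2 ⟨maximalIdeal R, inferInstance, ⟨LinearEquiv.refl R _⟩⟩

/-- On `Ext(k, X)` in the relevant degrees, `x` acts both injectively and as zero. -/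
theorem DepthAtLeast.of_quotSMulTop {n : ℕ} {x : R} (hx : x ∈ maximalIdeal R)
    (hreg : IsSMulRegular X x) (h : DepthAtLeast R n (QuotSMulTop x X)) :
    DepthAtLeast R (n + 1) X := by
  have hann := maximalIdeal_le_annihilator_residueField hx
  rintro (_ | i) hi
  · exact extVanishes_zero_iff.2
      (IsSMulRegular.linearMap_subsingleton_of_mem_annihilator hreg hann)
  · refine .of_forall fun e => ext_isSMulRegular_of_quotSMulTop hreg (h i (by omega)) ?_
    change x • e = x • 0
    rw [ext_smul_eq_zero_of_mem_annihilator hann, smul_zero]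

variable [IsNoetherianRing R]

theorem DepthAtLeast.exists_isSMulRegular [Module.Finite R X] {n : ℕ}
    (h : DepthAtLeast R (n + 1) X) : ∃ x ∈ maximalIdeal R, IsSMulRegular X x := by
  obtain ⟨_ | ⟨x, rs⟩, h1, h2, h3⟩ := depthAtLeast_iff_exists_isWeaklyRegular.1 h
  · simp at h3
  · exact ⟨x, h1 x (by simp), ((isWeaklyRegular_cons_iff _ _ _).1 h2).1⟩

theorem not_depthAtLeast_succ_of_ringKrullDim_eq [Module.Finite R X] [Nontrivial X] {d : ℕ}
    (hd : ringKrullDim R = d) : ¬ DepthAtLeast R (d + 1) X := by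
  intro h
  obtain ⟨rs, h1, h2, h3⟩ := depthAtLeast_iff_exists_isWeaklyRegular.1 h
  have h4 := IsWeaklyRegular.length_le_ringKrullDim h1 h2
  rw [hd, h3] at h4
  norm_cast at h4
  omega

/-- Here `t` is the exact depth of `X`. Dividing by a regular element lowers `t` and raises `a` by
one. At depth zero `k` embeds in `X`, and `Ext^n(X, ω) → Ext^n(k, ω)` is onto because `Ext^{n+1}`
vanishes. -/
theorem extVanishes_residueField_of_depth [Module.Finite R X] {n t a : ℕ}
    (h : ∀ (Z : Type u) [AddCommGroup Z] [Module R Z] [Module.Finite R Z],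
      ExtVanishes R Z ω (n + 1))
    (hX : DepthAtLeast R t X) (hX' : ¬ DepthAtLeast R (t + 1) X)
    (ha : ∀ i > a, ExtVanishes R X ω i) (hn : a + t < n) :
    ExtVanishes R (ResidueField R) ω n := by
  induction t generalizing X a with
  | zero =>
    have h0 : ¬ Subsingleton (ResidueField R →ₗ[R] X) := fun h0 => hX' fun i hi => by
      obtain rfl : i = 0 := by omega
      exact extVanishes_zero_iff.2 h0
    rw [not_subsingleton_iff_nontrivial] at h0
    obtain ⟨φ, hφ⟩ := exists_ne (0 : ResidueField R →ₗ[R] X)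
    have hinj := (LinearMap.injective_or_eq_zero φ).resolve_right hφ
    exact (ha n (by omega)).contravariant_left hinj (LinearMap.exact_map_mkQ_range φ)
      (Submodule.mkQ_surjective _) (h _)
  | succ t ih =>
    obtain ⟨x, hx, hreg⟩ := hX.exists_isSMulRegular
    refine ih (X := QuotSMulTop x X) (a := a + 1) (hX.quotSMulTop hreg)
      (fun h' => hX' (h'.of_quotSMulTop hx hreg)) ?_ (by omega)
    rintro (_ | i) hi
    · omega
    · exact (ha i (by omega)).contravariant_right (lsmul_injective hreg) (exact_lsmul_mkQ X x)
        (Submodule.mkQ_surjective _) (ha (i + 1) (by omega))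

/-- A prime filtration reduces to `R/p`. If `p` is not maximal, some `y` in the maximal ideal
outside `p` is regular on `R/p`, and Nakayama deduces degree `n` from degree `n + 1`. -/
theorem extVanishes_of_succ [Module.Finite R ω] {n : ℕ}
    (h : ∀ (Z : Type u) [AddCommGroup Z] [Module R Z] [Module.Finite R Z],
      ExtVanishes R Z ω (n + 1))
    (hk : ExtVanishes R (ResidueField R) ω n) [hX : Module.Finite R X] : ExtVanishes R X ω n := by
  induction hX using IsNoetherianRing.induction_on_isQuotientEquivQuotientPrime R with
  | subsingleton N =>
    refine .of_forall fun e => ?_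
    have : 𝟙 (ModuleCat.of R N) = 0 := ModuleCat.hom_ext (LinearMap.ext fun x =>
      Subsingleton.elim (α := N) _ _)
    rw [← e.mk₀_id_comp, this, Ext.mk₀_zero, Ext.zero_comp]
  | quotient N p e =>
    by_cases hp : p.asIdeal = maximalIdeal R
    · have e' : N ≃ₗ[R] ResidueField R := e.trans (Submodule.quotEquivOfEq _ _ hp)
      exact hk.congr e'.symm (LinearEquiv.refl R ω)
    · obtain ⟨y, hy, hyp⟩ := SetLike.not_le_iff_exists.1
        fun hle => hp ((le_maximalIdeal p.isPrime.ne_top).antisymm hle)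
      have hreg : IsSMulRegular N y := by
        rw [LinearEquiv.isSMulRegular_congr e, isSMulRegular_iff_right_eq_zero_of_smul]
        intro a ha
        obtain ⟨a, rfl⟩ := Ideal.Quotient.mk_surjective a
        change Ideal.Quotient.mk p.asIdeal (y * a) = 0 at ha
        rw [Ideal.Quotient.eq_zero_iff_mem] at ha ⊢
        exact (p.isPrime.mem_or_mem ha).resolve_left hyp
      exact (h (QuotSMulTop y N)).of_quotSMulTop_left hy hreg
  | exact N₁ N₂ N₃ f g hf hg hfg h₁ h₃ => exact h₁.contravariant_middle hf hfg hg h₃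

/-- The injective dimension of a module of finite injective dimension is at most the dimension of
the ring, if the ring is Cohen–Macaulay. -/
theorem extVanishes_of_hasInjectiveDimensionLE [Module.Finite R ω] {d : ℕ}
    (hd : ringKrullDim R = d) (hR : DepthAtLeast R d R) {n₀ : ℕ}
    (hω : HasInjectiveDimensionLE (ModuleCat.of R ω) n₀) [Module.Finite R X] {i : ℕ} (hi : d < i) :
    ExtVanishes R X ω i := by
  rcases Nat.lt_or_ge n₀ i with h | h
  · exact HasInjectiveDimensionLT.subsingleton _ (n₀ + 1) i h _
  -- Descending induction on the degree `n₀ + 1 - j`, stopping above `d`. The residue field is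
  -- handled with `X = R`, which is free of depth exactly `d`.
  · suffices ∀ j, ∀ (Z : Type u) [AddCommGroup Z] [Module R Z] [Module.Finite R Z],
        d < n₀ + 1 - j → ExtVanishes R Z ω (n₀ + 1 - j) by
      have h1 := this (n₀ + 1 - i) X
      rw [Nat.sub_sub_self (by omega)] at h1
      exact h1 hi
    intro j
    induction j with
    | zero => intro Z _ _ _ _; exact HasInjectiveDimensionLT.subsingleton _ (n₀ + 1) _ le_rfl _
    | succ j ih =>
      intro Z _ _ _ hj
      have h1 : ∀ (Z : Type u) [AddCommGroup Z] [Module R Z] [Module.Finite R Z],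
          ExtVanishes R Z ω (n₀ + 1 - (j + 1) + 1) := by
        intro Z _ _ _
        have := ih Z (by omega)
        rwa [show n₀ + 1 - (j + 1) + 1 = n₀ + 1 - j by omega]
      refine extVanishes_of_succ h1 (extVanishes_residueField_of_depth (X := R) (t := d) (a := 0)
        h1 hR (not_depthAtLeast_succ_of_ringKrullDim_eq hd) ?_ (by omega))
      rintro (_ | i) hi
      · omega
      · exact extVanishes_of_projective i

theorem IsCanonicalModule.isDualizing (hω : IsCanonicalModule R ω) (hR : IsCohenMacaulayLocal R)
    {d : ℕ} (hd : ringKrullDim R = d) : IsDualizing R ω d := by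
  have := hω.finite
  have := hω.nontrivial
  have hdepthR : DepthAtLeast R d R := by
    rw [depthAtLeast_iff_exists_isWeaklyRegular]
    rw [IsCohenMacaulayLocal, hd] at hR
    exact exists_isWeaklyRegular_of_moduleDepth_eq (by exact_mod_cast hR)
  have hdepth := hω.maximalCohenMacaulay.depthAtLeast hd
  obtain ⟨n, hn⟩ := hω.finite_injectiveDimension
  obtain ⟨t, ht, htype⟩ := hω.type_one
  have htd : t = d := by
    have h1 : (moduleDepth R ω : WithBot ℕ∞) ≤ ringKrullDim R := moduleDepth_le_ringKrullDim
    obtain ⟨rs, h2, h3, h4⟩ := depthAtLeast_iff_exists_isWeaklyRegular.1 hdepth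
    have h5 := le_moduleDepth h2 h3
    rw [h4, ht] at h5
    rw [ht, hd] at h1
    norm_cast at h1 h5
    omega
  subst htd
  exact ⟨hω.finite, hd, hdepthR, hdepth,
    fun X _ _ _ i hi => extVanishes_of_hasInjectiveDimensionLE hd hdepthR hn hi, htype⟩

omit [IsLocalRing R] [IsNoetherianRing R] in
theorem exact_lcomp {X₁ X₂ X₃ : Type u} [AddCommGroup X₁] [Module R X₁] [AddCommGroup X₂]
    [Module R X₂] [AddCommGroup X₃] [Module R X₃] {f : X₁ →ₗ[R] X₂} {g : X₂ →ₗ[R] X₃}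
    (h : Function.Exact f g) (hg : Function.Surjective g) :
    Function.Exact (LinearMap.lcomp R ω g) (LinearMap.lcomp R ω f) :=
  LinearMap.exact_lcomp_of_exact_of_surjective ω h hg

omit [IsLocalRing R] [IsNoetherianRing R] in
theorem lcomp_injective {X₂ X₃ : Type u} [AddCommGroup X₂]
    [Module R X₂] [AddCommGroup X₃] [Module R X₃] {g : X₂ →ₗ[R] X₃} (hg : Function.Surjective g) :
    Function.Injective (LinearMap.lcomp R ω g) :=
  LinearMap.lcomp_injective_of_surjective g hg

namespace IsDualizing

variable {d : ℕ} (hω : IsDualizing R ω d)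
include hω

/-- Dividing by a regular element trades one unit of depth for one degree of Ext, leaving `i + t`
unchanged. -/
theorem extVanishes_of_depthAtLeast [Module.Finite R X] {t i : ℕ} (hX : DepthAtLeast R t X)
    (hi : d < i + t) : ExtVanishes R X ω i := by
  have := hω.finite
  induction t generalizing X i with
  | zero => exact hω.extVanishes_of_gt X i hi
  | succ t ih =>
    obtain ⟨x, hx, hreg⟩ := hX.exists_isSMulRegular
    exact (ih (hX.quotSMulTop hreg) (by omega)).of_quotSMulTop_left hx hreg

theorem extVanishes_succ [Module.Finite R X] (hX : DepthAtLeast R d X) (i : ℕ) :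
    ExtVanishes R X ω (i + 1) :=
  hω.extVanishes_of_depthAtLeast hX (by omega)

theorem lcomp_surjective {X₁ X₂ X₃ : Type u} [AddCommGroup X₁] [Module R X₁] [AddCommGroup X₂]
    [Module R X₂] [AddCommGroup X₃] [Module R X₃] [Module.Finite R X₃] {f : X₁ →ₗ[R] X₂}
    {g : X₂ →ₗ[R] X₃} (hf : Function.Injective f) (h : Function.Exact f g)
    (hg : Function.Surjective g) (h₃ : DepthAtLeast R d X₃) :
    Function.Surjective (LinearMap.lcomp R ω f) := fun φ =>
  (hω.extVanishes_succ h₃ 0).exists_extension hf h hg φ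

/-- For a syzygy `0 → K → F → X → 0` the dual `0 → X^∨ → F^∨ → K^∨ → 0` is exact, and `K` is again
MCM. So `X^∨` gains one over the bound for `K^∨`, up to `d`; hence the induction over all `X` at
once. -/
theorem depthAtLeast_dual [Module.Finite R X] (hX : DepthAtLeast R d X) :
    DepthAtLeast R d (X →ₗ[R] ω) := by
  suffices ∀ t ≤ d, ∀ (X : Type u) [AddCommGroup X] [Module R X] [Module.Finite R X],
      DepthAtLeast R d X → DepthAtLeast R t (X →ₗ[R] ω) from this d le_rfl X hX
  intro t
  induction t with
  | zero => exact fun _ _ _ _ _ _ => depthAtLeast_zero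
  | succ t ih =>
    intro ht X _ _ _ hX
    obtain ⟨m, g, hg⟩ := Module.Finite.exists_fin' R X
    have hex : Function.Exact (LinearMap.ker g).subtype g := LinearMap.exact_subtype_ker_map g
    have hinj := Submodule.subtype_injective (LinearMap.ker g)
    refine DepthAtLeast.of_exact_left (lcomp_injective (ω := ω) hg) (exact_lcomp hex hg)
      (hω.lcomp_surjective hinj hex hg hX) ?_
      (ih (by omega) _ ((hω.depth_ring.pi m).of_exact_left' hinj hex hg hX))
    exact ((hω.depth.pi m).congr ((LinearMap.lsum R (fun _ : Fin m => R) R).symm.trans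
      (LinearEquiv.piCongrRight fun _ => LinearMap.ringLmapEquivSelf R R ω)).symm).mono ht

end IsDualizing

end Dualizing

/-! ### Reduction modulo a regular sequence -/

section RegularQuotient

open CategoryTheory Abelian IsLocalRing RingTheory.Sequence
open scoped Pointwise

variable {R : Type u} [CommRing R]
variable {X Y W E : Type u} [AddCommGroup X] [Module R X] [AddCommGroup Y] [Module R Y]
  [AddCommGroup W] [Module R W] [AddCommGroup E] [Module R E]

/-- The map `Hom(Y, E) → Ext^n(Y, W)` given by composition with a class in `Ext^n(E, W)`. -/
noncomputable def homCompExt (Y : Type u) [AddCommGroup Y] [Module R Y] {n : ℕ}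
    (θ : Ext (ModuleCat.of R E) (ModuleCat.of R W) n) :
    (Y →ₗ[R] E) →ₗ[R] Ext (ModuleCat.of R Y) (ModuleCat.of R W) n where
  toFun f := (Ext.mk₀ (ModuleCat.ofHom f)).comp θ (zero_add n)
  map_add' f g := by
    rw [show ModuleCat.ofHom (f + g) = ModuleCat.ofHom f + ModuleCat.ofHom g from rfl,
      Ext.mk₀_add, Ext.add_comp]
  map_smul' r f := by
    rw [show ModuleCat.ofHom (r • f) = r • ModuleCat.ofHom f from rfl,
      Ext.mk₀_smul, Ext.smul_comp, RingHom.id_apply]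

theorem extVanishes_of_ofList_le_annihilator {rs : List R} (h : IsWeaklyRegular W rs)
    (hY : Ideal.ofList rs ≤ Module.annihilator R Y) {i : ℕ} (hi : i < rs.length) :
    ExtVanishes R Y W i := by
  induction rs generalizing W i with
  | nil => simp at hi
  | cons r rs ih =>
    rw [isWeaklyRegular_cons_iff] at h
    rw [Ideal.ofList_cons, sup_le_iff, Ideal.span_singleton_le_iff_mem] at hY
    rcases i with _ | i
    · exact extVanishes_zero_iff.2 (IsSMulRegular.linearMap_subsingleton_of_mem_annihilator h.1 hY.1)
    · refine .of_forall fun e => ext_isSMulRegular_of_quotSMulTop h.1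
        (ih h.2 hY.2 (by simpa using hi)) ?_
      change r • e = r • 0
      rw [ext_smul_eq_zero_of_mem_annihilator hY.1, smul_zero]

theorem exists_smul_eq_of_mkQ_comp_eq_zero {r : R} (hr : IsSMulRegular W r) {g : X →ₗ[R] W}
    (hg : (r • (⊤ : Submodule R W)).mkQ ∘ₗ g = 0) : ∃ g' : X →ₗ[R] W, r • g' = g := by
  have hmem : ∀ x, g x ∈ LinearMap.range (LinearMap.lsmul R W r) := fun x =>
    (exact_lsmul_mkQ W r (g x)).1 (LinearMap.congr_fun hg x)
  refine ⟨(LinearEquiv.ofInjective _ (lsmul_injective hr)).symm.toLinearMap ∘ₗ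
    g.codRestrict _ hmem, ?_⟩
  ext x
  exact congrArg Subtype.val ((LinearEquiv.ofInjective _ (lsmul_injective hr)).apply_symm_apply
    (g.codRestrict _ hmem x))

/-- Reduction modulo a regular sequence `rs`: the quotient `E` of `W` by `rs` computes the
reductions of the modules `Hom(X, W)` if the modules `Ext^i(X, W)` vanish for `i > 0`, and the
modules `Ext^n(Y, W)` if `Y` is killed by `rs` and `n` is the length of `rs`. -/
theorem exists_regular_quotient (rs : List R) (W : Type u) [AddCommGroup W] [Module R W]
    (h : IsWeaklyRegular W rs) :
    ∃ (E : Type u) (_ : AddCommGroup E) (_ : Module R E) (π : W →ₗ[R] E),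
      Function.Surjective π ∧ LinearMap.ker π = Ideal.ofList rs • ⊤ ∧
      (∀ (X : Type u) [AddCommGroup X] [Module R X], (∀ i, ExtVanishes R X W (i + 1)) →
        (∀ f : X →ₗ[R] E, ∃ g : X →ₗ[R] W, π ∘ₗ g = f) ∧
        (∀ g : X →ₗ[R] W, π ∘ₗ g = 0 → g ∈ Ideal.ofList rs • (⊤ : Submodule R (X →ₗ[R] W)))) ∧
      ∃ θ : Ext (ModuleCat.of R E) (ModuleCat.of R W) rs.length,
        ∀ (Y : Type u) [AddCommGroup Y] [Module R Y],
          Ideal.ofList rs ≤ Module.annihilator R Y → Function.Bijective (homCompExt Y θ) := by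
  induction rs generalizing W with
  | nil =>
    refine ⟨W, _, _, LinearMap.id, Function.surjective_id, by simp, fun X _ _ _ =>
      ⟨fun f => ⟨f, rfl⟩, fun g hg => ?_⟩, Ext.mk₀ (𝟙 _), fun Y _ _ _ => ?_⟩
    · rw [LinearMap.id_comp] at hg
      rw [hg]
      exact Submodule.zero_mem _
    · have : ⇑(homCompExt Y (Ext.mk₀ (𝟙 (ModuleCat.of R W)))) =
          (Ext.mk₀ (X := ModuleCat.of R Y) (Y := ModuleCat.of R W)) ∘
            ModuleCat.homEquiv.symm := by
        ext f
        exact Ext.comp_mk₀_id _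
      change Function.Bijective (homCompExt Y (n := 0) _)
      rw [this]
      exact (Ext.mk₀_bijective _ _).comp (Equiv.bijective _)
  | cons r rs ih =>
    rw [isWeaklyRegular_cons_iff] at h
    have hinj := lsmul_injective h.1
    have hex := exact_lsmul_mkQ W r
    have hsurj := Submodule.mkQ_surjective (r • (⊤ : Submodule R W))
    obtain ⟨E, _, _, π, hπ, hker, hA, θ, hθ⟩ := ih (QuotSMulTop r W) h.2
    -- The class for `W` is the class for `W/rW` spliced with the extension `0 → W → W → W/rW → 0`.
    refine ⟨E, _, _, π ∘ₗ Submodule.mkQ _, hπ.comp hsurj, ?_, fun X _ _ hX => ?_,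
      θ.comp (shortExact_of_exact hinj hex hsurj).extClass rfl, fun Y _ _ hY => ?_⟩
    · rw [LinearMap.ker_comp, hker, Submodule.comap_smul_top_of_surjective _ _ hsurj,
        Submodule.ker_mkQ, Ideal.ofList_cons_smul, sup_comm]
    · obtain ⟨h1, h2⟩ := hA X fun i => (hX i).covariant_right hinj hex hsurj (hX (i + 1))
      have hlift : ∀ f : X →ₗ[R] QuotSMulTop r W, ∃ g : X →ₗ[R] W, Submodule.mkQ _ ∘ₗ g = f :=
        (hX 0).exists_lift hinj hex hsurj
      refine ⟨fun f => ?_, fun g hg => ?_⟩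
      · obtain ⟨f', rfl⟩ := h1 f
        obtain ⟨g, rfl⟩ := hlift f'
        exact ⟨g, rfl⟩
      · have h3 := h2 (Submodule.mkQ _ ∘ₗ g) hg
        have h4 : g ∈ (Ideal.ofList rs • (⊤ : Submodule R (X →ₗ[R] QuotSMulTop r W))).comap
          (LinearMap.compRight R (Submodule.mkQ (r • (⊤ : Submodule R W)))) := h3
        rw [Submodule.comap_smul_top_of_surjective _
          (LinearMap.compRight R (Submodule.mkQ (r • (⊤ : Submodule R W)))) hlift] at h4
        rw [Ideal.ofList_cons_smul, sup_comm]
        -- A map into `W` that vanishes modulo `r` is `r` times a map, since `r` is regular on `W`.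
        have hle : LinearMap.ker (LinearMap.compRight (M := X) R
            (Submodule.mkQ (r • (⊤ : Submodule R W)))) ≤ r • ⊤ := by
          intro g' hg'
          obtain ⟨g'', rfl⟩ := exists_smul_eq_of_mkQ_comp_eq_zero h.1 hg'
          exact Submodule.smul_mem_pointwise_smul _ _ _ trivial
        have h5 := sup_le_sup_left hle (Ideal.ofList rs • ⊤)
        exact h5 h4
    · have hY' := hY
      rw [Ideal.ofList_cons, sup_le_iff, Ideal.span_singleton_le_iff_mem] at hY'
      have hvan : ExtVanishes R Y W rs.length :=
        extVanishes_of_ofList_le_annihilator (rs := r :: rs)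
          ((isWeaklyRegular_cons_iff _ _ _).2 h) hY (by simp)
      have hcomp : ⇑(homCompExt Y (θ.comp (shortExact_of_exact hinj hex hsurj).extClass rfl)) =
          (fun e => e.comp (shortExact_of_exact hinj hex hsurj).extClass rfl) ∘
            homCompExt Y θ := by
        ext f
        exact (Ext.comp_assoc _ _ _ (zero_add _) rfl (by rw [zero_add])).symm
      change Function.Bijective (homCompExt Y (n := rs.length + 1) _)
      rw [hcomp]
      -- The connecting map is injective because `Ext^n(Y, W) = 0` for `n` the length of `rs`, and
      -- surjective because `r` kills `Ext^{n+1}(Y, W)`.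
      refine Function.Bijective.comp ⟨?_, ?_⟩ (hθ Y hY'.2)
      · refine (injective_iff_map_eq_zero (Ext.postcomp
          (shortExact_of_exact hinj hex hsurj).extClass (ModuleCat.of R Y) rfl)).2 fun e he => ?_
        obtain ⟨e', rfl⟩ := Ext.covariant_sequence_exact₃ _
          (shortExact_of_exact hinj hex hsurj) e rfl he
        rw [hvan.eq_zero e', Ext.zero_comp]
      · intro e
        exact Ext.covariant_sequence_exact₁ (ModuleCat.of R Y)
          (shortExact_of_exact hinj hex hsurj) e
          ((comp_mk₀_lsmul r e).trans (ext_smul_eq_zero_of_mem_annihilator hY'.1 e)) rfl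

/-- If `Hom(-, E)` is `Ext^n(-, W)` via `θ`, then maps to `E` extend along an injection whose
cokernel has vanishing `Ext^{n+1}(-, W)`. -/
theorem exists_extension_of_bijective_homCompExt {Z : Type u} [AddCommGroup Z] [Module R Z] {n : ℕ}
    {θ : Ext (ModuleCat.of R E) (ModuleCat.of R W) n}
    (hY : Function.Injective (homCompExt Y θ)) (hZ : Function.Surjective (homCompExt Z θ))
    {X₃ : Type u} [AddCommGroup X₃] [Module R X₃] {j : Y →ₗ[R] Z} {p : Z →ₗ[R] X₃}
    (hj : Function.Injective j) (h : Function.Exact j p) (hp : Function.Surjective p)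
    (hvan : ExtVanishes R X₃ W (n + 1)) (f : Y →ₗ[R] E) : ∃ g : Z →ₗ[R] E, g ∘ₗ j = f := by
  obtain ⟨x, hx⟩ := Ext.contravariant_sequence_exact₁ (shortExact_of_exact hj h hp)
    (ModuleCat.of R W) (homCompExt Y θ f) (add_comm 1 n) (hvan.eq_zero _)
  obtain ⟨g, rfl⟩ := hZ x
  exact ⟨g, hY ((Ext.mk₀_comp_mk₀_assoc (ModuleCat.ofHom j) (ModuleCat.ofHom g) θ).symm.trans hx)⟩

end RegularQuotient

/-! ### Length counts over an Artinian quotient -/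

section Length

open IsLocalRing

variable {R : Type u} [CommRing R] [IsLocalRing R] {E : Type u} [AddCommGroup E] [Module R E]

/-- Hom is left exact, and each composition factor of `Y` is `k`, contributing at most one. -/
theorem length_hom_le (hk : Module.length R (ResidueField R →ₗ[R] E) ≤ 1) {Y : Type u}
    [AddCommGroup Y] [Module R Y] (hY : IsFiniteLength R Y) :
    Module.length R (Y →ₗ[R] E) ≤ Module.length R Y := by
  induction hY with
  | of_subsingleton => simp
  | @of_simple_quotient M _ _ N hsimple hN ih =>
    obtain ⟨I, hI, ⟨e⟩⟩ := isSimpleModule_iff_quot_maximal (R := R).1 hsimple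
    obtain rfl := eq_maximalIdeal hI
    have h1 : Module.length R ((M ⧸ N) →ₗ[R] E) ≤ Module.length R (M ⧸ N) := by
      rw [Module.length_eq_one (R := R) (M := M ⧸ N)]
      exact ((LinearEquiv.congrLeft E R e).length_eq).trans_le hk
    have hex := exact_lcomp (ω := E) (LinearMap.exact_subtype_mkQ N) N.mkQ_surjective
    have h2 := Module.length_eq_add_of_exact (LinearMap.lcomp R E N.mkQ)
      (LinearMap.lcomp R E N.subtype).rangeRestrict (lcomp_injective N.mkQ_surjective)
      (LinearMap.surjective_rangeRestrict _) (fun x => by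
        rw [← hex x, ← LinearMap.mem_ker, LinearMap.ker_rangeRestrict, LinearMap.mem_ker])
    rw [h2, Module.length_eq_add_of_exact N.subtype N.mkQ N.subtype_injective N.mkQ_surjective
      (LinearMap.exact_subtype_mkQ N), add_comm]
    exact add_le_add ((Module.length_le_of_injective _ (Submodule.subtype_injective _)).trans ih) h1

theorem exists_surjective_residueField [Module.Finite R E] [Nontrivial E] :
    ∃ f : E →ₗ[R] ResidueField R, Function.Surjective f := by
  obtain ⟨N, hN, -⟩ := (eq_top_or_exists_le_coatom (⊥ : Submodule R E)).resolve_left bot_ne_top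
  obtain ⟨I, hI, ⟨e⟩⟩ := isSimpleModule_iff_quot_maximal.1 (isSimpleModule_iff_isCoatom.2 hN)
  obtain rfl := eq_maximalIdeal hI
  exact ⟨e.toLinearMap ∘ₗ N.mkQ, e.surjective.comp N.mkQ_surjective⟩

/-- A faithful module over an Artinian ring `R/I` with simple socle has no endomorphisms other than
the multiplications by ring elements. -/
theorem exists_smul_id_eq_of_annihilator_eq {I : Ideal R}
    (hk : Module.length R (ResidueField R →ₗ[R] E) ≤ 1) (hA : IsFiniteLength R (R ⧸ I))
    (hI : Module.annihilator R E = I) (h : E →ₗ[R] E) : ∃ r : R, r • LinearMap.id = h := by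
  have hIE := hI.ge
  have hfaith := hI.le
  -- `E` embeds in `Hom(R/I, E)` by evaluation at scalars.
  have hlenE : Module.length R E ≤ Module.length R (R ⧸ I) := by
    let ev : E →ₗ[R] (R ⧸ I) →ₗ[R] E :=
      { toFun e := Submodule.liftQ I (LinearMap.toSpanSingleton R E e) fun a ha =>
          Module.mem_annihilator.1 (hIE ha) e
        map_add' e e' := LinearMap.ext fun q => by
          obtain ⟨a, rfl⟩ := Ideal.Quotient.mk_surjective q
          exact smul_add a e e'
        map_smul' r e := LinearMap.ext fun q => by
          obtain ⟨a, rfl⟩ := Ideal.Quotient.mk_surjective q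
          exact smul_comm a r e }
    refine (Module.length_le_of_injective ev fun e e' h => ?_).trans (length_hom_le hk hA)
    have h1 : (1 : R) • e = (1 : R) • e' := LinearMap.congr_fun h (Ideal.Quotient.mk I 1)
    rwa [one_smul, one_smul] at h1
  have hAtop : Module.length R (R ⧸ I) ≠ ⊤ := Module.length_ne_top_iff.2 hA
  have hE : IsFiniteLength R E := Module.length_ne_top_iff.1 (ne_top_of_le_ne_top hAtop hlenE)
  let ψ : (R ⧸ I) →ₗ[R] (E →ₗ[R] E) := Submodule.liftQ I (LinearMap.lsmul R E) fun a ha =>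
    LinearMap.ext fun e => Module.mem_annihilator.1 (hIE ha) e
  have hψ : Function.Injective ψ := by
    rw [← LinearMap.ker_eq_bot]
    refine Submodule.ker_liftQ_eq_bot _ _ _ fun a ha => hfaith ?_
    exact Module.mem_annihilator.2 fun e => LinearMap.congr_fun ha e
  have h1 := Module.length_eq_add_of_exact ψ (LinearMap.range ψ).mkQ hψ
    (Submodule.mkQ_surjective _) (LinearMap.exact_map_mkQ_range ψ)
  have h2 := (length_hom_le hk hE).trans hlenE
  rw [h1] at h2
  -- `R/I` embeds in `End E`, whose length is at most that of `E`, hence of `R/I`; finiteness leaves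
  -- no room for a cokernel.
  have h3 : Module.length R ((E →ₗ[R] E) ⧸ LinearMap.range ψ) = 0 := by
    lift Module.length R (R ⧸ I) to ℕ using hAtop with a
    generalize Module.length R ((E →ₗ[R] E) ⧸ LinearMap.range ψ) = c at h2
    induction c using ENat.recTopCoe with
    | top => simp at h2
    | coe c =>
      norm_cast at h2 ⊢
      omega
  rw [Module.length_eq_zero_iff, Submodule.Quotient.subsingleton_iff] at h3
  obtain ⟨q, rfl⟩ := LinearMap.range_eq_top.1 h3 h
  obtain ⟨r, rfl⟩ := Ideal.Quotient.mk_surjective q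
  exact ⟨r, LinearMap.ext fun e => rfl⟩

end Length

/-! ### Endomorphisms of the canonical module -/

section EndDualizing

open CategoryTheory Abelian IsLocalRing RingTheory.Sequence

variable {R : Type u} [CommRing R] [IsLocalRing R] [IsNoetherianRing R]
variable {ω : Type u} [AddCommGroup ω] [Module R ω]

omit [IsLocalRing R] [IsNoetherianRing R] in
theorem exists_comp_eq_of_ker_le {A B C : Type*} [AddCommGroup A] [Module R A] [AddCommGroup B]
    [Module R B] [AddCommGroup C] [Module R C] {p : A →ₗ[R] B} (hp : Function.Surjective p)
    {f : A →ₗ[R] C} (h : LinearMap.ker p ≤ LinearMap.ker f) : ∃ f' : B →ₗ[R] C, f' ∘ₗ p = f := by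
  refine ⟨(LinearMap.ker p).liftQ f h ∘ₗ (p.quotKerEquivOfSurjective hp).symm.toLinearMap, ?_⟩
  ext a
  have : (p.quotKerEquivOfSurjective hp).symm (p a) = Submodule.Quotient.mk a := by
    rw [LinearEquiv.symm_apply_eq]
    rfl
  simp [this]

/-- An element regular on `X × Y` is regular on both factors. -/
theorem exists_common_isWeaklyRegular {X Y : Type u} [AddCommGroup X] [Module R X]
    [AddCommGroup Y] [Module R Y] [Module.Finite R X] [Module.Finite R Y] {n : ℕ}
    (hX : DepthAtLeast R n X) (hY : DepthAtLeast R n Y) :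
    ∃ rs : List R, (∀ r ∈ rs, r ∈ maximalIdeal R) ∧ IsWeaklyRegular X rs ∧
      IsWeaklyRegular Y rs ∧ rs.length = n := by
  have hXY : DepthAtLeast R n (X × Y) := DepthAtLeast.of_exact_middle
    (f := LinearMap.inl R X Y) (g := LinearMap.snd R X Y) LinearMap.inl_injective
    Function.Exact.inl_snd LinearMap.snd_surjective hX hY
  induction n generalizing X Y with
  | zero => exact ⟨[], by simp, IsWeaklyRegular.nil _ _, IsWeaklyRegular.nil _ _, rfl⟩
  | succ n ih =>
    obtain ⟨x, hx, hreg⟩ := hXY.exists_isSMulRegular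
    have hxX : IsSMulRegular X x := fun a b hab => congrArg Prod.fst
      (@hreg (a, 0) (b, 0) (Prod.ext hab rfl))
    have hxY : IsSMulRegular Y x := fun a b hab => congrArg Prod.snd
      (@hreg (0, a) (0, b) (Prod.ext rfl hab))
    have h1 := hX.quotSMulTop hxX
    have h2 := hY.quotSMulTop hxY
    obtain ⟨rs, h3, h4, h5, h6⟩ := ih h1 h2 (DepthAtLeast.of_exact_middle
      (f := LinearMap.inl R _ _) (g := LinearMap.snd R _ _) LinearMap.inl_injective
      Function.Exact.inl_snd LinearMap.snd_surjective h1 h2)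
    exact ⟨x :: rs, by simpa using ⟨hx, h3⟩, h4.cons hxX, h5.cons hxY, by simp [h6]⟩

/-- A regular sequence of length `d` cuts the dimension to zero, and a Noetherian ring of dimension
zero is Artinian. -/
theorem isFiniteLength_quotient_ofList {d : ℕ} (hd : ringKrullDim R = d) {rs : List R}
    (hrs : ∀ r ∈ rs, r ∈ maximalIdeal R) (h : IsWeaklyRegular R rs) (hlen : rs.length = d) :
    IsFiniteLength R (R ⧸ Ideal.ofList rs) := by
  have hreg := IsRegular.of_isWeaklyRegular_of_mem_maximalIdeal R hrs h
  have h1 := Module.supportDim_add_length_eq_supportDim_of_isRegular rs hreg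
  rw [Module.supportDim_self_eq_ringKrullDim, hd, hlen, smul_eq_mul, Ideal.mul_top,
    Module.supportDim_quotient_eq_ringKrullDim] at h1
  have h2 : ringKrullDim (R ⧸ Ideal.ofList rs) ≤ 0 := by
    have h0 : ringKrullDim (R ⧸ Ideal.ofList rs) + (d : ℕ) ≤ (0 : WithBot ℕ∞) + (d : ℕ) := by
      rw [h1, zero_add]
    exact (ENat.WithBot.add_le_add_natCast_right_iff).1 h0
  have h3 : IsArtinianRing (R ⧸ Ideal.ofList rs) := by
    rw [isArtinianRing_iff_isNoetherianRing_krullDimLE_zero]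
    exact ⟨inferInstance, Order.krullDimLE_iff _ _ |>.2 h2⟩
  have h4 : IsArtinian R (R ⧸ Ideal.ofList rs) :=
    isArtinian_of_surjective_algebraMap (S := R) (R := R ⧸ Ideal.ofList rs)
      Ideal.Quotient.mk_surjective
  exact isFiniteLength_iff_isNoetherian_isArtinian.2 ⟨inferInstance, h4⟩

namespace IsDualizing

/-- The endomorphisms of a canonical module are the multiplications by ring elements. -/
theorem lsmul_bijective {d : ℕ} (hω : IsDualizing R ω d) :
    Function.Bijective (LinearMap.lsmul R ω) := by
  have := hω.finite
  obtain ⟨rs, hrs, hrsR, hrsω, hlen⟩ := exists_common_isWeaklyRegular hω.depth_ring hω.depth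
  subst hlen
  have hA := isFiniteLength_quotient_ofList hω.ringKrullDim_eq hrs hrsR rfl
  obtain ⟨E, _, _, π, hπ, hker, hred, θ, hθ⟩ := exists_regular_quotient rs ω hrsω
  set I := Ideal.ofList rs with hI
  have hIm : I ≤ maximalIdeal R := Ideal.span_le.2 hrs
  have hIk : I ≤ Module.annihilator R (ResidueField R) :=
    hIm.trans maximalIdeal_le_annihilator_residueField
  have hIE : I ≤ Module.annihilator R E := fun a ha => Module.mem_annihilator.2 fun e => by
    obtain ⟨w, rfl⟩ := hπ e
    rw [← map_smul, ← LinearMap.mem_ker, hker]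
    exact Submodule.smul_mem_smul ha trivial
  have hIA : I ≤ Module.annihilator R (R ⧸ I) := Ideal.annihilator_quotient.ge
  have : Module.Finite R E := Module.Finite.of_surjective π hπ
  obtain ⟨etype⟩ := hω.type_one
  -- Type one enters here: `Hom(k, E)` is `Ext^d(k, ω)`, which is `k`.
  have hk : Module.length R (ResidueField R →ₗ[R] E) ≤ 1 := by
    rw [← Module.length_eq_one (R := R) (M := ResidueField R)]
    exact Module.length_le_of_injective (etype.toLinearMap ∘ₗ homCompExt (ResidueField R) θ)
      (etype.injective.comp (hθ _ hIk).1)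
  obtain ⟨φ, hφ⟩ : ∃ φ : ResidueField R →ₗ[R] E, φ ≠ 0 := by
    obtain ⟨φ, hφ⟩ := (hθ _ hIk).2 (etype.symm 1)
    refine ⟨φ, ?_⟩
    rintro rfl
    rw [map_zero, eq_comm, LinearEquiv.map_eq_zero_iff] at hφ
    exact one_ne_zero hφ
  have hne : ∀ (Y : Type u) [AddCommGroup Y] [Module R Y] [Module.Finite R Y] [Nontrivial Y],
      ∃ f : Y →ₗ[R] E, f ≠ 0 := by
    intro Y _ _ _ _
    obtain ⟨s, hs⟩ := exists_surjective_residueField (R := R) (E := Y)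
    refine ⟨φ ∘ₗ s, fun h0 => hφ ?_⟩
    refine LinearMap.ext fun c => ?_
    obtain ⟨y, rfl⟩ := hs c
    exact LinearMap.congr_fun h0 y
  -- If `a ∉ I` killed `E`, a nonzero map from the ideal of `R/I` generated by `a` would extend to
  -- `g` on `R/I`, as `Ext^{d+1}(-, ω) = 0`; but then `g(a) = a • g(1) = 0`.
  have hfaith : Module.annihilator R E ≤ I := by
    intro a ha
    by_contra haI
    let Y : Submodule R (R ⧸ I) := Submodule.span R {Ideal.Quotient.mk I a}
    have hmemY : Ideal.Quotient.mk I a ∈ Y := Submodule.mem_span_singleton_self _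
    have : Nontrivial Y := by
      refine ⟨⟨⟨_, hmemY⟩, 0, fun h0 => haI ?_⟩⟩
      exact Ideal.Quotient.eq_zero_iff_mem.1 (congrArg Subtype.val h0)
    obtain ⟨f, hf⟩ := hne Y
    have hIY : I ≤ Module.annihilator R Y := hIA.trans
      (LinearMap.annihilator_le_of_injective Y.subtype Y.subtype_injective)
    obtain ⟨g, hgf⟩ := exists_extension_of_bijective_homCompExt (hθ _ hIY).1 (hθ _ hIA).2
      Y.subtype_injective (LinearMap.exact_subtype_mkQ Y) Y.mkQ_surjective
      (hω.extVanishes_of_gt ((R ⧸ I) ⧸ Y) (rs.length + 1) (Nat.lt_succ_self _)) f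
    refine hf (LinearMap.ext fun y => ?_)
    obtain ⟨c, hc⟩ := Submodule.mem_span_singleton.1 y.2
    rw [← hgf]
    change g y.1 = 0
    have h1 : Ideal.Quotient.mk I a = a • (1 : R ⧸ I) := by
      rw [Algebra.smul_def, mul_one]; rfl
    rw [← hc, h1, map_smul, map_smul, Module.mem_annihilator.1 ha, smul_zero]
  have hendE := exists_smul_id_eq_of_annihilator_eq hk hA (le_antisymm hfaith hIE)
  -- An endomorphism of `ω` induces one of `E`, which is a scalar; so `End ω = R·id + I·End ω`, and
  -- Nakayama applies.
  have hsurj : Function.Surjective (LinearMap.lsmul R ω) := by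
    rw [← LinearMap.range_eq_top, eq_top_iff]
    refine Submodule.le_of_le_smul_of_le_jacobson_bot (I := I) Module.Finite.fg_top ?_
      fun h _ => ?_
    · rwa [jacobson_eq_maximalIdeal _ bot_ne_top]
    · have hle : LinearMap.ker π ≤ LinearMap.ker (π ∘ₗ h) := by
        rw [LinearMap.ker_comp, hker, ← Submodule.map_le_iff_le_comap, Submodule.map_smul'']
        exact Submodule.smul_mono le_rfl le_top
      obtain ⟨h', hh'⟩ := exists_comp_eq_of_ker_le hπ hle
      obtain ⟨r, rfl⟩ := hendE h'
      have hr' : π ∘ₗ (h - LinearMap.lsmul R ω r) = 0 := by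
        ext w
        have h1 : r • π w = π (h w) := LinearMap.congr_fun hh' w
        simp [h1]
      have h3 := (hred ω (hω.extVanishes_succ hω.depth)).2 _ hr'
      rw [← sub_add_cancel h (LinearMap.lsmul R ω r), add_comm]
      exact Submodule.add_mem_sup (LinearMap.mem_range_self _ r) h3
  refine ⟨?_, hsurj⟩
  rw [← LinearMap.ker_eq_bot]
  by_contra hK
  have hKnt : Nontrivial (LinearMap.ker (LinearMap.lsmul R ω)) :=
    Submodule.nontrivial_iff_ne_bot.2 hK
  have hex := LinearMap.exact_subtype_ker_map (LinearMap.lsmul R ω)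
  have hinj := Submodule.subtype_injective (LinearMap.ker (LinearMap.lsmul R ω))
  have hH := hω.depthAtLeast_dual hω.depth
  have hKdepth := hω.depth_ring.of_exact_left' hinj hex hsurj hH
  -- The kernel is MCM, so a nonzero map from it to `E` lifts to `ω` and then extends to `R`. The
  -- extension kills the kernel, whose elements annihilate `ω`.
  obtain ⟨f, hf⟩ := hne (LinearMap.ker (LinearMap.lsmul R ω))
  obtain ⟨f, rfl⟩ := (hred _ (hω.extVanishes_succ hKdepth)).1 f
  obtain ⟨g, rfl⟩ := hω.lcomp_surjective hinj hex hsurj hH f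
  refine hf (LinearMap.ext fun x => ?_)
  have h1 : g x.1 = x.1 • g 1 := by rw [← map_smul, smul_eq_mul, mul_one]
  have h2 : x.1 • g 1 = 0 := LinearMap.congr_fun x.2 (g 1)
  change π (g x.1) = 0
  rw [h1, h2, map_zero]

end IsDualizing

end EndDualizing

/-! ### Biduality for MCM modules -/

section Biduality

variable {R : Type u} [CommRing R]

theorem nonempty_linearEquiv_of_ker_eq {A B C : Type*} [AddCommGroup A] [Module R A]
    [AddCommGroup B] [Module R B] [AddCommGroup C] [Module R C] {p : A →ₗ[R] B} {q : A →ₗ[R] C}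
    (hp : Function.Surjective p) (hq : Function.Surjective q)
    (h : LinearMap.ker p = LinearMap.ker q) : Nonempty (B ≃ₗ[R] C) :=
  ⟨(p.quotKerEquivOfSurjective hp).symm ≪≫ₗ Submodule.quotEquivOfEq _ _ h ≪≫ₗ
    q.quotKerEquivOfSurjective hq⟩

/-- The evaluation map from a module to its bidual with respect to `ω`. -/
def evalBidual (R : Type u) [CommRing R] (ω X : Type u) [AddCommGroup ω] [Module R ω] [AddCommGroup X] [Module R X] :
    X →ₗ[R] (X →ₗ[R] ω) →ₗ[R] ω :=
  (LinearMap.id : (X →ₗ[R] ω) →ₗ[R] X →ₗ[R] ω).flip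

variable {ω X : Type u} [AddCommGroup ω] [Module R ω] [AddCommGroup X] [Module R X]

@[simp]
theorem evalBidual_apply (x : X) (f : X →ₗ[R] ω) : evalBidual R ω X x f = f x := rfl

theorem evalBidual_pi_bijective (h : Function.Bijective (LinearMap.lsmul R ω)) (n : ℕ) :
    Function.Bijective (evalBidual R ω (Fin n → R)) := by
  constructor
  · rw [injective_iff_map_eq_zero]
    intro x hx
    funext i
    refine h.1 (LinearMap.ext fun w => ?_)
    simpa using LinearMap.congr_fun hx
      (LinearMap.toSpanSingleton R ω w ∘ₗ LinearMap.proj (R := R) (φ := fun _ => R) i)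
  · intro Φ
    -- Restricted to the `i`-th copy of `ω` in the dual of `R^n`, `Φ` is an endomorphism of `ω`,
    -- hence a scalar `r i`.
    choose r hr using fun i => h.2 (Φ ∘ₗ
      (LinearMap.lcomp R ω (LinearMap.proj (R := R) (φ := fun _ : Fin n => R) i)) ∘ₗ
        (LinearMap.ringLmapEquivSelf R R ω).symm.toLinearMap)
    refine ⟨r, LinearMap.ext fun f => ?_⟩
    have hf : f = ∑ i, LinearMap.lcomp R ω (LinearMap.proj (R := R) (φ := fun _ : Fin n => R) i)
        ((LinearMap.ringLmapEquivSelf R R ω).symm (f (Pi.single i 1))) := by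
      ext i
      simp [Pi.single_apply]
    have hr' : ∀ i w, r i • w = Φ (LinearMap.lcomp R ω
        (LinearMap.proj (R := R) (φ := fun _ : Fin n => R) i)
        ((LinearMap.ringLmapEquivSelf R R ω).symm w)) := fun i w => LinearMap.congr_fun (hr i) w
    conv_rhs => rw [hf, map_sum]
    simp_rw [← hr']
    rw [evalBidual_apply]
    conv_lhs => rw [pi_eq_sum_univ' r, map_sum]
    simp

variable [IsLocalRing R] [IsNoetherianRing R]

namespace IsDualizing

variable {d : ℕ} (hω : IsDualizing R ω d)
include hω

/-- For a free cover `F → X` with kernel `K`, the module `K^∨` is MCM, so `F^∨∨ → X^∨∨` is onto; and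
`F = F^∨∨`. -/
theorem evalBidual_surjective [Module.Finite R X] (hX : DepthAtLeast R d X) :
    Function.Surjective (evalBidual R ω X) := by
  have := hω.finite
  intro Φ
  obtain ⟨m, g, hg⟩ := Module.Finite.exists_fin' R X
  have hex := LinearMap.exact_subtype_ker_map g
  have hinj := Submodule.subtype_injective (LinearMap.ker g)
  have hK := (hω.depth_ring.pi m).of_exact_left' hinj hex hg hX
  obtain ⟨Φ', rfl⟩ := hω.lcomp_surjective (lcomp_injective (ω := ω) hg) (exact_lcomp hex hg)
    (hω.lcomp_surjective hinj hex hg hX) (hω.depthAtLeast_dual hK) Φ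
  obtain ⟨y, rfl⟩ := (evalBidual_pi_bijective hω.lsmul_bijective m).2 Φ'
  exact ⟨g y, rfl⟩

theorem evalBidual_bijective [Module.Finite R X] (hX : DepthAtLeast R d X) :
    Function.Bijective (evalBidual R ω X) := by
  refine ⟨?_, hω.evalBidual_surjective hX⟩
  rw [injective_iff_map_eq_zero]
  intro x hx
  obtain ⟨m, g, hg⟩ := Module.Finite.exists_fin' R X
  have hex := LinearMap.exact_subtype_ker_map g
  have hinj := Submodule.subtype_injective (LinearMap.ker g)
  have hK := (hω.depth_ring.pi m).of_exact_left' hinj hex hg hX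
  obtain ⟨y, rfl⟩ := hg x
  -- Evaluation at `y` vanishes on `X^∨`, so it descends to `K^∨`. Surjectivity for `K` makes it
  -- evaluation at some `z ∈ K`, whence `y = z` and `x = 0`.
  obtain ⟨Ψ, hΨ⟩ := exists_comp_eq_of_ker_le (hω.lcomp_surjective hinj hex hg hX)
    (f := evalBidual R ω _ y) fun f hf => by
      obtain ⟨f', rfl⟩ := (exact_lcomp hex hg f).1 hf
      exact LinearMap.congr_fun hx f'
  obtain ⟨z, rfl⟩ := hω.evalBidual_surjective hK Ψ
  have hyz : y = z.1 := (evalBidual_pi_bijective hω.lsmul_bijective m).1 hΨ.symm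
  rw [hyz]
  exact z.2

end IsDualizing

end Biduality

/-! ### The transpose and the theorem -/

section Transpose

variable {R : Type u} [CommRing R] [IsLocalRing R] [IsNoetherianRing R]
variable {ω M N F₀ F₁ : Type u} [AddCommGroup ω] [Module R ω] [AddCommGroup M] [Module R M]
  [AddCommGroup N] [Module R N] [AddCommGroup F₀] [Module R F₀] [AddCommGroup F₁] [Module R F₁]

omit [IsNoetherianRing R] in
theorem DepthAtLeast.tensor_free [Module.Free R F₀] [Module.Finite R F₀] {n : ℕ}
    (hN : DepthAtLeast R n N) : DepthAtLeast R n (F₀ ⊗[R] N) :=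
  (hN.pi (Module.finrank R F₀)).congr
    (TensorProduct.congr (Module.finBasis R F₀).equivFun (LinearEquiv.refl R N) ≪≫ₗ
      TensorProduct.comm R _ _ ≪≫ₗ TensorProduct.piScalarRight R R N _).symm

/-- `F^* ⊗ Hom(N, ω) ≃ Hom(F ⊗ N, ω)` for finite free modules `F`. -/
noncomputable def dualTensorHomCurryEquiv (F N ω : Type u) [AddCommGroup F] [Module R F]
    [AddCommGroup N] [Module R N] [AddCommGroup ω] [Module R ω] [Module.Free R F]
    [Module.Finite R F] :
    Module.Dual R F ⊗[R] (N →ₗ[R] ω) ≃ₗ[R] (F ⊗[R] N →ₗ[R] ω) :=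
  dualTensorHomEquiv R F (N →ₗ[R] ω) ≪≫ₗ TensorProduct.lift.equiv (RingHom.id R) F N ω

omit [IsLocalRing R] [IsNoetherianRing R] in
theorem lcomp_rTensor_comp_dualTensorHomCurryEquiv [Module.Free R F₀] [Module.Finite R F₀]
    [Module.Free R F₁] [Module.Finite R F₁] (δ : F₁ →ₗ[R] F₀) :
    LinearMap.lcomp R ω (δ.rTensor N) ∘ₗ (dualTensorHomCurryEquiv F₀ N ω).toLinearMap =
      (dualTensorHomCurryEquiv F₁ N ω).toLinearMap ∘ₗ δ.dualMap.rTensor (N →ₗ[R] ω) := by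
  ext φ g x y
  simp [dualTensorHomCurryEquiv]

/-- If `M` has a free presentation `F₁ → F₀ → M → 0` with transpose `T`, and `N` and `M ⊗ N` are
maximal Cohen–Macaulay, then `T ⊗ Hom(N, ω)` is maximal Cohen–Macaulay: it is the canonical dual
of the kernel of `F₁ ⊗ N → F₀ ⊗ N`. -/
theorem IsDualizing.depthAtLeast_transpose_tensor_dual {d : ℕ} (hω : IsDualizing R ω d)
    [Module.Free R F₀] [Module.Finite R F₀] [Module.Free R F₁] [Module.Finite R F₁]
    [Module.Finite R M] [Module.Finite R N] {δ : F₁ →ₗ[R] F₀} {aug : F₀ →ₗ[R] M}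
    (hex : Function.Exact δ aug) (haug : Function.Surjective aug)
    (hN : DepthAtLeast R d N) (hMN : DepthAtLeast R d (M ⊗[R] N)) :
    DepthAtLeast R d ((Module.Dual R F₁ ⧸ LinearMap.range δ.dualMap) ⊗[R] (N →ₗ[R] ω)) := by
  have hα : Function.Surjective (aug.rTensor N) := LinearMap.rTensor_surjective N haug
  have hβα : Function.Exact (δ.rTensor N) (aug.rTensor N) := rTensor_exact N hex haug
  set α := aug.rTensor N
  let β : F₁ ⊗[R] N →ₗ[R] LinearMap.ker α :=
    (δ.rTensor N).codRestrict _ fun x => (hβα _).2 ⟨x, rfl⟩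
  have hβ : Function.Surjective β := by
    rintro ⟨x, hx⟩
    obtain ⟨y, rfl⟩ := (hβα x).1 hx
    exact ⟨y, rfl⟩
  have hexα := LinearMap.exact_subtype_ker_map α
  have hinjα := Submodule.subtype_injective (LinearMap.ker α)
  have hexβ := LinearMap.exact_subtype_ker_map β
  have hinjβ := Submodule.subtype_injective (LinearMap.ker β)
  have hK : DepthAtLeast R d (LinearMap.ker α) :=
    (hN.tensor_free (F₀ := F₀)).of_exact_left' hinjα hexα hα hMN
  have hL : DepthAtLeast R d (LinearMap.ker β) :=
    (hN.tensor_free (F₀ := F₁)).of_exact_left' hinjβ hexβ hβ hK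
  -- A map on `F₁ ⊗ N` vanishing on `ker β` factors through `ker α`, and extends to `F₀ ⊗ N` because
  -- `Ext^1(M ⊗ N, ω) = 0`.
  have hdual : Function.Exact (LinearMap.lcomp R ω (δ.rTensor N))
      (LinearMap.lcomp R ω (LinearMap.ker β).subtype) := by
    intro f
    rw [exact_lcomp hexβ hβ f]
    constructor
    · rintro ⟨g, rfl⟩
      obtain ⟨h, rfl⟩ := hω.lcomp_surjective hinjα hexα hα hMN g
      exact ⟨h, rfl⟩
    · rintro ⟨h, rfl⟩
      exact ⟨h ∘ₗ (LinearMap.ker α).subtype, rfl⟩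
  have hT : Function.Exact (δ.dualMap.rTensor (N →ₗ[R] ω))
      ((LinearMap.range δ.dualMap).mkQ.rTensor (N →ₗ[R] ω)) :=
    rTensor_exact _ (LinearMap.exact_map_mkQ_range _) (Submodule.mkQ_surjective _)
  -- Both quotients of `F₁^* ⊗ N^∨` have as kernel the image of `δ^* ⊗ 1`.
  have hker : LinearMap.ker (LinearMap.lcomp R ω (LinearMap.ker β).subtype ∘ₗ
      (dualTensorHomCurryEquiv F₁ N ω).toLinearMap) =
      LinearMap.ker ((LinearMap.range δ.dualMap).mkQ.rTensor (N →ₗ[R] ω)) := by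
    rw [hT.linearMap_ker_eq, LinearMap.ker_comp, hdual.linearMap_ker_eq]
    ext x
    rw [Submodule.mem_comap, LinearMap.mem_range, LinearMap.mem_range,
      (dualTensorHomCurryEquiv F₀ N ω).surjective.exists]
    refine exists_congr fun y => ?_
    have := LinearMap.congr_fun (lcomp_rTensor_comp_dualTensorHomCurryEquiv (ω := ω) (N := N) δ) y
    simp only [LinearMap.comp_apply, LinearEquiv.coe_coe] at this ⊢
    rw [this, EmbeddingLike.apply_eq_iff_eq]
  have hsurj : Function.Surjective (LinearMap.lcomp R ω (LinearMap.ker β).subtype ∘ₗ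
      (dualTensorHomCurryEquiv F₁ N ω).toLinearMap) :=
    (hω.lcomp_surjective hinjβ hexβ hβ hK).comp (LinearEquiv.surjective _)
  obtain ⟨e⟩ := nonempty_linearEquiv_of_ker_eq (A := Module.Dual R F₁ ⊗[R] (N →ₗ[R] ω))
    (B := LinearMap.ker β →ₗ[R] ω)
    (C := (Module.Dual R F₁ ⧸ LinearMap.range δ.dualMap) ⊗[R] (N →ₗ[R] ω)) hsurj
    (LinearMap.rTensor_surjective _ (Submodule.mkQ_surjective _)) hker
  exact (hω.depthAtLeast_dual hL).congr e

end Transpose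

theorem theorem4 (R : Type u) [CommRing R] [IsNoetherianRing R] [IsLocalRing R]
    (hR : IsCohenMacaulayLocal R)
    (ω : Type u) [AddCommGroup ω] [Module R ω] (hω : IsCanonicalModule R ω)
    (M : Type u) [AddCommGroup M] [Module R M] [Module.Finite R M]
    (N : Type u) [AddCommGroup N] [Module R N] [Module.Finite R N]
    (hN : IsMaximalCohenMacaulay R N)
    (F : MinimalFreePresentation R M) :
    IsMaximalCohenMacaulay R (M ⊗[R] N) ↔
      IsMaximalCohenMacaulay R (F.transpose ⊗[R] (N →ₗ[R] ω)) := by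
  obtain ⟨d, hd⟩ : ∃ d : ℕ, ringKrullDim R = d := by
    obtain ⟨d, hd⟩ := WithBot.ne_bot_iff_exists.1 (ringKrullDim_ne_bot (R := R))
    obtain ⟨d, rfl⟩ := ENat.ne_top_iff_exists.1 fun h : d = ⊤ =>
      ringKrullDim_ne_top (R := R) (by rw [← hd, h]; rfl)
    exact ⟨d, hd.symm⟩
  have hω := hω.isDualizing hR hd
  have := hω.finite
  rw [isMaximalCohenMacaulay_iff hd] at hN
  rw [isMaximalCohenMacaulay_iff hd, isMaximalCohenMacaulay_iff hd]
  refine ⟨hω.depthAtLeast_transpose_tensor_dual F.exact F.aug_surjective hN, fun h => ?_⟩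
  -- The same implication for the presentation `F₀^* → F₁^* → Tr M → 0` and the module `N^∨`.
  have h1 := hω.depthAtLeast_transpose_tensor_dual (LinearMap.exact_map_mkQ_range F.d.dualMap)
    (Submodule.mkQ_surjective _) (hω.depthAtLeast_dual hN) h
  -- Evaluation `F ≃ F^**` identifies the cokernel of the double transpose of the differential with
  -- `M`.
  obtain ⟨e⟩ := nonempty_linearEquiv_of_ker_eq
    (p := (LinearMap.range F.d.dualMap.dualMap).mkQ)
    (q := F.aug ∘ₗ (Module.evalEquiv R (Fin F.m → R)).symm.toLinearMap)
    (Submodule.mkQ_surjective _) (F.aug_surjective.comp (LinearEquiv.surjective _)) (by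
      rw [Submodule.ker_mkQ, LinearMap.ker_comp, F.exact.linearMap_ker_eq]
      ext x
      rw [Submodule.mem_comap, LinearMap.mem_range, LinearMap.mem_range,
        (Module.evalEquiv R (Fin F.n → R)).surjective.exists]
      refine exists_congr fun y => ?_
      rw [LinearEquiv.coe_coe, LinearEquiv.eq_symm_apply]
      exact Iff.of_eq (congrArg (· = x) rfl))
  exact h1.congr (TensorProduct.congr e
    (LinearEquiv.ofBijective _ (hω.evalBidual_bijective hN)).symm)
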